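/- Let $M$ be a nonempty smooth manifold of dimension $4n$ ($n\ge 1$) with an $\mathrm{Sp}(1)\mathrm{GL}(n,\mathbb H)$-structure $Q$ that admits a torsion-free connection; thus $M$ is a quaternionic manifold if $n\ge 2$, while for $n=1$ every self-dual conformal $4$-manifold is included. Here $\mathrm{Sp}(1)\mathrm{GL}(n,\mathbb H)$ is the group of the transformations $v\mapsto q\,A(v)$ of $\mathbb H^n$ with $q$ a unit quaternion and $A$ an automorphism of the left $\mathbb H$-module $\mathbb H^n$. Left multiplication by $\mathrm{Sp}(1)$ on $\mathbb H^n$ induces an $\mathrm{Sp}(1)$-action on the exterior forms on $\mathbb H^n$. Let $E_{k,r}\subseteq\Lambda^kT^*M$ be the bundle associated with $Q$ and the sum of all irreducible $\mathrm{Sp}(1)$-representations of highest weight $r$ in the $k$-forms on $\mathbb H^n$, so that $\Lambda^kT^*M=\bigoplus_r E_{k,r}$; let $\pi_{k,r}:\Lambda^kT^*M\to E_{k,r}$ be the natural projection, and let $$\mathcal D=\pi_{k+1,r+1}\circ d:\ C^\infty(E_{k,r})\to C^\infty(E_{k+1,r+1}).$$ For $0\le k\le 2n$ consider the complex $$0\to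 E_{2k,0}\xrightarrow{\mathcal D}E_{2k+1,1}\xrightarrow{\mathcal D}E_{2k+2,2}\xrightarrow{\mathcal D}\cdots\xrightarrow{\mathcal D}E_{2n+k,2n-k}\xrightarrow{\mathcal D}0 .$$ It is called elliptic at one of its terms if the sequence of principal symbols $\sigma_{\mathcal D}(x,\xi)$ is exact at that term for all $x\in M$ and all $0\ne\xi\in T^*_xM$. Then: 1. If $2k\ge 4$, the complex is elliptic everywhere except at $E_{2k,0}$ and $E_{2k+1,1}$, where it is not elliptic (for $k=2n$ the complex consists of $E_{4n,0}$ only, and the claim about $E_{2k+1,1}$ is void). 2. If $k=1$, the complex is elliptic everywhere except at $E_{3,1}$, where it is not elliptic. 3. If $k=0$, the complex is elliptic everywhere. -/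

import Mathlib

open scoped Manifold ContDiff Quaternion Topology

noncomputable section

namespace QuaternionicForms

/-! ### The model space `ℍⁿ`, its forms and the group `Sp(1)GL(n,ℍ)` -/

/-- `ℍⁿ`, a left `ℍ`-module. -/
abbrev HSpace (n : ℕ) : Type := Fin n → ℍ[ℝ]

/-- Membership in `Sp(1)GL(n,ℍ)`: the transformations `v ↦ q A(v)` of `ℍⁿ` with `q` a unit
quaternion and `A` an automorphism of the left `ℍ`-module `ℍⁿ`. -/
def MemSp1GL {n : ℕ} (g : HSpace n ≃L[ℝ] HSpace n) : Prop :=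
  ∃ q : ℍ[ℝ], ‖q‖ = 1 ∧ ∃ A : HSpace n ≃ₗ[ℍ[ℝ]] HSpace n, ∀ v, g v = q • A v

/-- Membership in the Lie algebra `sp(1) + gl(n,ℍ)` of `Sp(1)GL(n,ℍ)`: the endomorphisms
`v ↦ a v + A(v)` with `a` an imaginary quaternion and `A` an `ℍ`-linear endomorphism. -/
def MemLieSp1GL {n : ℕ} (T : HSpace n → HSpace n) : Prop :=
  ∃ a : ℍ[ℝ], a.re = 0 ∧ ∃ A : HSpace n →ₗ[ℍ[ℝ]] HSpace n, ∀ v, T v = a • v + A v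

/-- Left multiplication by a quaternion. -/
def leftMul (n : ℕ) (q : ℍ[ℝ]) : HSpace n →L[ℝ] HSpace n :=
  q • ContinuousLinearMap.id ℝ (HSpace n)

/-- The action of `q ∈ sp(1) = Im ℍ` on the alternating forms on `ℍⁿ` induced from left
multiplication on `ℍⁿ`: the derivative at `t = 0` of `exp(-tq)^* α`, that is
`(q · α)(v₁, …, v_k) = -∑ⱼ α(v₁, …, q vⱼ, …, v_k)`. -/
def sp1Action {n k : ℕ} {F : Type*} [NormedAddCommGroup F] [NormedSpace ℝ F]
    (q : ℍ[ℝ]) (α : HSpace n [⋀^Fin k]→L[ℝ] F) : HSpace n [⋀^Fin k]→L[ℝ] F :=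
  α.fderivCompContinuousLinearMap (ContinuousLinearMap.id ℝ (HSpace n)) (-leftMul n q)

/-- The imaginary unit `i`; in `sp(1) = Im ℍ` one has `[i,j] = 2k`, `[j,k] = 2i`, `[k,i] = 2j`. -/
def qI : ℍ[ℝ] := ⟨0, 1, 0, 0⟩

/-- The imaginary unit `j`. -/
def qJ : ℍ[ℝ] := ⟨0, 0, 1, 0⟩

/-- The imaginary unit `k`. -/
def qK : ℍ[ℝ] := ⟨0, 0, 0, 1⟩

/-- `α` is a highest weight vector of weight `r` (or zero) for `sp(1) ⊗ ℂ = sl(2,ℂ)`: the Cartan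
element `H = -√-1 I` acts by `r`, and the raising operator `J - √-1 K` (for which
`[H, J - √-1 K] = 2 (J - √-1 K)`) kills `α`. -/
def IsHighestWeight {n k : ℕ} (r : ℕ) (α : HSpace n [⋀^Fin k]→L[ℝ] ℂ) : Prop :=
  sp1Action qI α = (Complex.I * (r : ℂ)) • α ∧ sp1Action qJ α - Complex.I • sp1Action qK α = 0

/-- The sum of all the irreducible `sp(1)`-representations of highest weight `r` in the
complex-valued `k`-forms on `ℍⁿ`: the smallest `sp(1)`-invariant complex subspace that contains
all highest weight vectors of weight `r`. -/
def modelEC (n k r : ℕ) : Submodule ℂ (HSpace n [⋀^Fin k]→L[ℝ] ℂ) :=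
  sInf {W | (∀ q : ℍ[ℝ], q.re = 0 → ∀ α ∈ W, sp1Action q α ∈ W) ∧
    ∀ α, IsHighestWeight r α → α ∈ W}

/-- The real `k`-forms on `ℍⁿ` in `modelEC n k r`. -/
def modelE (n k r : ℕ) : Submodule ℝ (HSpace n [⋀^Fin k]→L[ℝ] ℝ) :=
  ((modelEC n k r).restrictScalars ℝ).comap
    (ContinuousLinearMap.compContinuousAlternatingMapₗ ℝ (HSpace n) ℝ ℂ Complex.ofRealCLM)

/-! ### Quaternionic manifolds -/

section Manifold

variable {n : ℕ} {M : Type*} [TopologicalSpace M]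
  [ChartedSpace (EuclideanSpace ℝ (Fin (4 * n))) M]

/-- `p` is a smooth frame field on `U`, i.e. all the vector fields `y ↦ p_y⁻¹(v)` are smooth. -/
def SmoothFrameOn [IsManifold (𝓡 (4 * n)) ∞ M]
    (p : ∀ y : M, TangentSpace (𝓡 (4 * n)) y ≃L[ℝ] HSpace n) (U : Set M) : Prop :=
  ∀ v : HSpace n, ContMDiffOn (𝓡 (4 * n)) (𝓡 (4 * n)).tangent ∞
    (fun y => (⟨y, (p y).symm v⟩ : TangentBundle (𝓡 (4 * n)) M)) U

variable (n M) in
/-- An `Sp(1)GL(n,ℍ)`-structure on a `4n`-manifold: a principal subbundle of the frame bundle with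
structure group `Sp(1)GL(n,ℍ)`. -/
structure Sp1GLStructure [IsManifold (𝓡 (4 * n)) ∞ M] where
  /-- The frames at `x` that belong to the structure. -/
  frames : ∀ x : M, Set (TangentSpace (𝓡 (4 * n)) x ≃L[ℝ] HSpace n)
  /-- Each fibre is one orbit of the structure group. -/
  mem_iff : ∀ (x : M), ∀ p ∈ frames x, ∀ p' : TangentSpace (𝓡 (4 * n)) x ≃L[ℝ] HSpace n,
    p' ∈ frames x ↔ MemSp1GL (p.symm.trans p')
  /-- There are smooth local sections. -/
  exists_section : ∀ x : M, ∃ U ∈ 𝓝 x,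
    ∃ p : ∀ y : M, TangentSpace (𝓡 (4 * n)) y ≃L[ℝ] HSpace n,
      (∀ y ∈ U, p y ∈ frames y) ∧ SmoothFrameOn p U

variable [IsManifold (𝓡 (4 * n)) ∞ M]

/-- A linear connection is a connection on the `Sp(1)GL(n,ℍ)`-structure `Q`: in each smooth local
section of `Q` the connection form takes its values in the Lie algebra of the structure group. -/
def Sp1GLStructure.IsPreservedBy (Q : Sp1GLStructure n M)
    (cov : CovariantDerivative (𝓡 (4 * n)) (EuclideanSpace ℝ (Fin (4 * n)))
      (TangentSpace (𝓡 (4 * n)) : M → Type _)) : Prop :=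
  ∀ (U : Set M) (p : ∀ y : M, TangentSpace (𝓡 (4 * n)) y ≃L[ℝ] HSpace n), IsOpen U →
    (∀ y ∈ U, p y ∈ Q.frames y) → SmoothFrameOn p U →
    ∀ y ∈ U, ∀ X : TangentSpace (𝓡 (4 * n)) y,
      MemLieSp1GL fun v => p y (cov (fun z => (p z).symm v) y X)

/-- The structure `Q` is integrable, so that `(M, Q)` is a quaternionic manifold: `Q` admits a
(smooth) torsion-free connection. For `n = 1`, where an `Sp(1)GL(1,ℍ)`-structure is an oriented
conformal structure, this always holds; self-dual conformal 4-manifolds are thus included. -/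
def Sp1GLStructure.IsQuaternionic (Q : Sp1GLStructure n M) : Prop :=
  ∃ cov : CovariantDerivative (𝓡 (4 * n)) (EuclideanSpace ℝ (Fin (4 * n)))
      (TangentSpace (𝓡 (4 * n)) : M → Type _),
    cov.ContMDiffCovariantDerivative ∞ ∧ cov.torsion = 0 ∧ Q.IsPreservedBy cov

/-! ### Differential forms and the exterior derivative -/

variable (n) in
/-- The real `k`-covectors at `x`: the fibre of `Λᵏ T*M`. -/
abbrev Covectors (k : ℕ) (x : M) : Type :=
  TangentSpace (𝓡 (4 * n)) x [⋀^Fin k]→L[ℝ] ℝ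

/-- The coordinate expression of a differential `k`-form `η` in the chart at `x`: its pullback
along the inverse of the chart. -/
def localRep {k : ℕ} (η : ∀ y : M, Covectors n k y) (x : M)
    (e : EuclideanSpace ℝ (Fin (4 * n))) :
    EuclideanSpace ℝ (Fin (4 * n)) [⋀^Fin k]→L[ℝ] ℝ :=
  (η ((extChartAt (𝓡 (4 * n)) x).symm e)).compContinuousLinearMap
    (mfderiv 𝓘(ℝ, EuclideanSpace ℝ (Fin (4 * n))) (𝓡 (4 * n))
      (extChartAt (𝓡 (4 * n)) x).symm e)

/-- Smoothness of a differential `k`-form. -/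
def SmoothForm {k : ℕ} (η : ∀ y : M, Covectors n k y) : Prop :=
  ∀ x : M, ContDiffOn ℝ ∞ (localRep η x) (extChartAt (𝓡 (4 * n)) x).target

/-- The exterior derivative on `M`, computed in the chart at each point. -/
def extD {k : ℕ} (η : ∀ y : M, Covectors n k y) (x : M) : Covectors n (k + 1) x :=
  (extDeriv (localRep η x) (extChartAt (𝓡 (4 * n)) x x)).compContinuousLinearMap
    (mfderiv (𝓡 (4 * n)) 𝓘(ℝ, EuclideanSpace ℝ (Fin (4 * n))) (extChartAt (𝓡 (4 * n)) x) x)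

/-! ### The bundles `E_{k,r}`, the operators `𝒟` and their principal symbols -/

namespace Sp1GLStructure

variable (Q : Sp1GLStructure n M)

/-- The fibre at `x` of the bundle `E_{k,r} ⊆ Λᵏ T*M`, associated with `Q` and the
subrepresentation `modelE n k r` of the `k`-forms on `ℍⁿ`. -/
def E (k r : ℕ) (x : M) : Submodule ℝ (Covectors n k x) :=
  ⨅ p ∈ Q.frames x, (modelE n k r).comap
    (ContinuousAlternatingMap.compContinuousLinearMapₗ (p.symm : HSpace n →L[ℝ] _))

open Classical in
/-- The natural projection `π_{k,r}` of `Λᵏ T*M = ⨁ₛ E_{k,s}` onto `E_{k,r}` (the value of the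
second branch is irrelevant, as the two spaces are complementary). -/
def proj (k r : ℕ) (x : M) : Covectors n k x →ₗ[ℝ] Q.E k r x :=
  if h : IsCompl (Q.E k r x) (⨆ s : ℕ, ⨆ _ : s ≠ r, Q.E k s x) then
    Submodule.projectionOnto _ _ h
  else 0

/-- The operator `𝒟 = π_{k+1,r+1} ∘ d`, to be applied to sections of `E_{k,r}`. -/
def opD (k r : ℕ) (η : ∀ y : M, Covectors n k y) (x : M) : Q.E (k + 1) (r + 1) x :=
  Q.proj (k + 1) (r + 1) x (extD η x)

/-- `σ` is the principal symbol at the covector `ξ` at `x` of the first order operator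
`𝒟 : C^∞(E_{k,r}) → C^∞(E_{k+1,r+1})`: one has `σ (s x) = 𝒟 (f s) (x)` for each smooth section `s`
of `E_{k,r}` and each smooth function `f` with `f x = 0` and `df_x = ξ`. -/
def IsPrincipalSymbol (k r : ℕ) (x : M) (ξ : TangentSpace (𝓡 (4 * n)) x →L[ℝ] ℝ)
    (σ : Q.E k r x →ₗ[ℝ] Q.E (k + 1) (r + 1) x) : Prop :=
  ∀ (f : M → ℝ) (s : ∀ y : M, Q.E k r y), ContMDiff (𝓡 (4 * n)) 𝓘(ℝ, ℝ) ∞ f → f x = 0 →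
    mfderiv (𝓡 (4 * n)) 𝓘(ℝ, ℝ) f x = ξ → SmoothForm (fun y => (s y : Covectors n k y)) →
    σ (s x) = Q.opD k r (fun y => f y • (s y : Covectors n k y)) x

open Classical in
/-- The principal symbol `σ_𝒟(x, ξ) : E_{k,r} → E_{k+1,r+1}` (it exists and is unique). -/
def symbol (k r : ℕ) (x : M) (ξ : TangentSpace (𝓡 (4 * n)) x →L[ℝ] ℝ) :
    Q.E k r x →ₗ[ℝ] Q.E (k + 1) (r + 1) x :=
  if h : ∃ σ, Q.IsPrincipalSymbol k r x ξ σ then h.choose else 0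

/-- The upward complex `0 → E_{2k,0} → E_{2k+1,1} → E_{2k+2,2} → …` is elliptic at its `j`-th term
`E_{2k+j,j}`: the principal symbol sequence is exact there for all nonzero covectors. (The last
nonzero term is `E_{2n+k,2n-k}`, for `j = 2n - k`; the map that leaves it has a zero target.) -/
def EllipticAt (k : ℕ) : ℕ → Prop
  | 0 => ∀ (x : M) (ξ : TangentSpace (𝓡 (4 * n)) x →L[ℝ] ℝ), ξ ≠ 0 →
      Function.Injective (Q.symbol (2 * k) 0 x ξ)
  | j + 1 => ∀ (x : M) (ξ : TangentSpace (𝓡 (4 * n)) x →L[ℝ] ℝ), ξ ≠ 0 →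
      Function.Exact (Q.symbol (2 * k + j) j x ξ) (Q.symbol (2 * k + j + 1) (j + 1) x ξ)

end Sp1GLStructure

end Manifold

end QuaternionicForms

end

/-!
Fix a nonzero real covector `ξ` on `ℍⁿ` and complexify. The `Sp(1)`-action makes the forms a
representation of `sl₂`, and `ξ = e₁ + f₂` with `e₁` of weight `1` and `f₂ = Y e₂` of weight `-1`
for a second one-form `e₂` of weight `1`. A form of type `r` is a sum `∑ (r - i)! Yⁱ aᵢ` with
`a₀, …, a_r` of highest weight, and in these coordinates the symbol of `𝒟` at `ξ` is
multiplication of the polynomial `∑ aᵢ tⁱ` by the pencil `e₁ + t e₂`. On highest weight vectors of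
positive weight, `e₁ p = 0` forces `p = e₁ q` and `e₁ p = e₂ p = 0` forces `p = e₁ e₂ u`; comparing
coefficients of powers of `t` gives exactness from the third term on.

At the first two terms invariant forms obstruct exactness. With `I, J, K` acting on covectors, the
two-form `φ = ξ ∧ Iξ + Jξ ∧ Kξ` is invariant and `φ² = 2 ξ ∧ Iξ ∧ Jξ ∧ Kξ` is killed by `ξ`, so
`φ² ρ` with `ρ` invariant lies in the kernel of the first symbol. Likewise the form `Iξ ∧ φ ρ` of
type `1` is in the kernel of the second symbol but not in the image of the first.

All this passes to the manifold through the frames of `Q`, because `d(f s) = df ∧ s` at a zero of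
`f` expresses the symbol as the component of type `r + 1` of `ξ ∧ s`.
-/

noncomputable section

namespace QuaternionicForms

section Calculus

open ContinuousAlternatingMap

/-- The `𝕜`-valued alternating `k`-forms on `E`. Linearity on `E` is over `ℝ`, so that the
complex-valued forms are the complexification of the real ones. -/
abbrev Form (𝕜 E : Type*) [RCLike 𝕜] [NormedAddCommGroup E] [NormedSpace ℝ E] (k : ℕ) :=
  E [⋀^Fin k]→L[ℝ] 𝕜

/-- The `𝕜`-valued one-forms on `E`. -/
abbrev OneForm (𝕜 E : Type*) [RCLike 𝕜] [NormedAddCommGroup E] [NormedSpace ℝ E] :=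
  E →L[ℝ] 𝕜

variable {𝕜 𝕜' : Type*} [RCLike 𝕜] [RCLike 𝕜'] {E E' : Type*} [NormedAddCommGroup E]
  [NormedSpace ℝ E] [NormedAddCommGroup E'] [NormedSpace ℝ E'] {k : ℕ}

-- Without these shortcuts, lemmas on modules such as `smul_zero` do not match the scalar action
-- at reducible transparency.
instance : AddCommGroup (Form 𝕜 E k) := inferInstance
instance : AddCommGroup (OneForm 𝕜 E) := inferInstance

/-- The wedge product `ξ ∧ α` of a one-form and a `k`-form. -/
def wedge : OneForm 𝕜 E →ₗ[𝕜] Form 𝕜 E k →ₗ[𝕜] Form 𝕜 E (k + 1) :=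
  LinearMap.mk₂ 𝕜 (fun ξ α => alternatizeUncurryFin (ξ.smulRight α))
    (fun ξ η α => by rw [← alternatizeUncurryFin_add]; congr 1; ext; simp [add_mul])
    (fun c ξ α => by rw [← alternatizeUncurryFin_smul]; congr 1; ext; simp [mul_assoc])
    (fun ξ α β => by rw [← alternatizeUncurryFin_add]; congr 1; ext; simp)
    (fun c ξ α => by rw [← alternatizeUncurryFin_smul]; congr 1; ext; simp [mul_left_comm])

lemma wedge_apply (ξ : OneForm 𝕜 E) (α : Form 𝕜 E k) (v : Fin (k + 1) → E) :
    wedge ξ α v = ∑ i : Fin (k + 1), (-1) ^ (i : ℕ) * (ξ (v i) * α (i.removeNth v)) := by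
  simp [wedge, alternatizeUncurryFin_apply]

/-- The contraction `ι_v α`. -/
def contr : E →ₗ[ℝ] Form 𝕜 E (k + 1) →ₗ[𝕜] Form 𝕜 E k where
  toFun v :=
    { toFun := fun α => α.curryLeft v
      map_add' := fun _ _ => rfl
      map_smul' := fun _ _ => rfl }
  map_add' u v := by ext α : 1; exact map_add α.curryLeft u v
  map_smul' c v := by ext α : 1; exact map_smul α.curryLeft c v

@[simp] lemma contr_apply (v : E) (α : Form 𝕜 E (k + 1)) (w : Fin k → E) :
    contr v α w = α (Matrix.vecCons v w) := rfl

lemma ext_contr {α β : Form 𝕜 E (k + 1)} (h : ∀ v, contr v α = contr v β) : α = β := by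
  ext w
  simpa using DFunLike.congr_fun (h (Matrix.vecHead w)) (Matrix.vecTail w)

lemma contr_wedge_zero (v : E) (ξ : OneForm 𝕜 E) (α : Form 𝕜 E 0) :
    contr v (wedge ξ α) = ξ v • α := by
  ext w
  simp [wedge_apply, Subsingleton.elim _ w]

lemma zeroForm_eq_zero_of_wedge_eq_zero {ξ : OneForm 𝕜 E} (hξ : ξ ≠ 0) {α : Form 𝕜 E 0}
    (h : wedge ξ α = 0) : α = 0 := by
  obtain ⟨v, hv⟩ := DFunLike.ne_iff.mp hξ
  have hsmul := contr_wedge_zero v ξ α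
  rw [h, _root_.map_zero] at hsmul
  exact (smul_eq_zero.mp hsmul.symm).resolve_left hv

lemma contr_wedge (v : E) (ξ : OneForm 𝕜 E) (α : Form 𝕜 E (k + 1)) :
    contr v (wedge ξ α) = ξ v • α - wedge ξ (contr v α) := by
  ext w
  have hremove (i : Fin (k + 1)) :
      i.succ.removeNth (Matrix.vecCons v w) = Matrix.vecCons v (i.removeNth w) := by
    funext j
    cases j using Fin.cases <;> simp [Fin.removeNth]
  simp [wedge_apply, Fin.sum_univ_succ (n := k + 1), hremove, pow_succ, sub_eq_add_neg]

lemma contr_self (u : E) (α : Form 𝕜 E (k + 2)) : contr u (contr u α) = 0 :=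
  α.curryLeft_same u

lemma contr_contr_comm (u v : E) (α : Form 𝕜 E (k + 2)) :
    contr u (contr v α) = -contr v (contr u α) := by
  have h := contr_self (u + v) α
  simp only [map_add, LinearMap.add_apply, contr_self, zero_add, add_zero] at h
  exact eq_neg_of_add_eq_zero_right h

lemma wedge_wedge_comm : ∀ {k : ℕ} (ξ η : OneForm 𝕜 E) (α : Form 𝕜 E k),
    wedge ξ (wedge η α) = -wedge η (wedge ξ α)
  | 0, ξ, η, α => ext_contr fun v => by
    simp only [contr_wedge, contr_wedge_zero, map_neg, map_smul]
    abel
  | k + 1, ξ, η, α => ext_contr fun v => by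
    simp only [contr_wedge, map_neg, map_smul, map_sub, wedge_wedge_comm ξ η (contr v α)]
    abel

lemma wedge_self (ξ : OneForm 𝕜 E) (α : Form 𝕜 E k) : wedge ξ (wedge ξ α) = 0 :=
  have : IsAddTorsionFree (Form 𝕜 E (k + 2)) := .of_module_rat _
  self_eq_neg.mp (wedge_wedge_comm ξ ξ α)

lemma wedge_compContinuousLinearMap (L : E' →L[ℝ] E) (ξ : OneForm 𝕜 E) (α : Form 𝕜 E k) :
    (wedge ξ α).compContinuousLinearMap L
      = wedge (ξ ∘L L) (α.compContinuousLinearMap L) := by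
  ext v
  simp only [wedge_apply, compContinuousLinearMap_apply]
  rfl

lemma fderivCompContinuousLinearMap_id_apply (T : E →L[ℝ] E) (α : Form 𝕜 E k) (v : Fin k → E) :
    α.fderivCompContinuousLinearMap (.id ℝ E) T v
      = ∑ i, α (Function.update v i (T (v i))) := by
  refine (fderivCompContinuousLinearMap_apply ..).trans (Finset.sum_congr rfl fun i _ => ?_)
  congr 1
  funext j
  obtain rfl | h := eq_or_ne j i <;> simp [*]

/-- The derivation `α ↦ -∑ⱼ α(…, T vⱼ, …)` of the forms on `E` induced by an endomorphism `T`. -/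
def der : (E →L[ℝ] E) →ₗ[ℝ] Form 𝕜 E k →ₗ[𝕜] Form 𝕜 E k :=
  LinearMap.mk₂' ℝ 𝕜 (fun T α => α.fderivCompContinuousLinearMap (.id ℝ E) (-T))
    (fun S T α => by simp [add_comm])
    (fun c T α => by rw [← smul_neg, map_smul])
    (fun T α β => by
      ext; simp [Finset.sum_add_distrib, add_comm])
    (fun c T α => by ext; simp [Finset.mul_sum])

lemma der_apply (T : E →L[ℝ] E) (α : Form 𝕜 E k) (v : Fin k → E) :
    der T α v = -∑ i, α (Function.update v i (T (v i))) := by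
  change α.fderivCompContinuousLinearMap (.id ℝ E) (-T) v = _
  rw [map_neg, ContinuousAlternatingMap.neg_apply, fderivCompContinuousLinearMap_id_apply]

@[simp] lemma der_zero_form (T : E →L[ℝ] E) (α : Form 𝕜 E 0) : der T α = 0 := by
  ext v; simp [der_apply]

lemma contr_der (T : E →L[ℝ] E) (v : E) (α : Form 𝕜 E (k + 1)) :
    contr v (der T α) = der T (contr v α) - contr (T v) α := by
  ext w
  have hzero : Function.update (Matrix.vecCons v w) 0 (T v) = Matrix.vecCons (T v) w :=
    Fin.update_cons_zero ..
  have hsucc (i : Fin k) : Function.update (Matrix.vecCons v w) i.succ (T (w i))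
      = Matrix.vecCons v (Function.update w i (T (w i))) := (Fin.cons_update ..).symm
  simp [der_apply, Fin.sum_univ_succ, hzero, hsucc, sub_eq_add_neg, add_comm]

lemma der_wedge : ∀ {k : ℕ} (T : E →L[ℝ] E) (ξ : OneForm 𝕜 E) (α : Form 𝕜 E k),
    der T (wedge ξ α) = wedge (-(ξ ∘L T)) α + wedge ξ (der T α)
  | 0, T, ξ, α => ext_contr fun v => by
    simp [-map_neg, contr_der, contr_wedge_zero]
  | k + 1, T, ξ, α => ext_contr fun v => by
    simp only [contr_der, contr_wedge, map_sub, map_smul, der_wedge T ξ (contr v α), map_add,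
      neg_smul, _root_.neg_apply, ContinuousLinearMap.comp_apply]
    abel

lemma der_lie : ∀ {k : ℕ} (S T : E →L[ℝ] E) (α : Form 𝕜 E k),
    der S (der T α) - der T (der S α) = der (S * T - T * S) α
  | 0, S, T, α => by simp
  | k + 1, S, T, α => ext_contr fun v => by
    rw [contr_der, ← der_lie S T (contr v α)]
    simp only [map_sub, contr_der, LinearMap.sub_apply, _root_.sub_apply,
      mul_apply_eq_comp]
    abel

lemma der_compContinuousLinearMap {L : E' →L[ℝ] E} {S : E' →L[ℝ] E'} {T : E →L[ℝ] E}
    (h : L ∘L S = T ∘L L) (α : Form 𝕜 E k) :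
    der S (α.compContinuousLinearMap L) = (der T α).compContinuousLinearMap L := by
  ext v
  have hupdate (i : Fin k) : ⇑L ∘ Function.update v i (S (v i))
      = Function.update (⇑L ∘ v) i (T (L (v i))) := by
    rw [Function.comp_update, ← ContinuousLinearMap.comp_apply L, h]; rfl
  simp [der_apply, hupdate]

lemma sum_wedge_contr {ι : Type*} [Fintype ι] (b : Module.Basis ι ℝ E) (x : ι → OneForm 𝕜 E)
    (hx : ∀ i v, x i v = (b.repr v i : 𝕜)) (α : Form 𝕜 E (k + 1)) :
    ∑ i, wedge (x i) (contr (b i) α) = ((k : 𝕜) + 1) • α := by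
  have hcurry : ∑ i, (x i).smulRight (contr (b i) α) = α.curryLeft := by
    ext1 v
    conv_rhs => rw [← b.sum_repr v]
    simp only [_root_.sum_apply, ContinuousLinearMap.smulRight_apply, hx, _root_.map_sum,
      map_smul]
    refine Finset.sum_congr rfl fun i _ => ?_
    ext; simp [RCLike.real_smul_eq_coe_mul]
  calc ∑ i, wedge (x i) (contr (b i) α) = alternatizeUncurryFin α.curryLeft := by
        rw [← hcurry, ← alternatizeUncurryFinCLM_apply, _root_.map_sum]; rfl
    _ = ((k : 𝕜) + 1) • α := by
        rw [alternatizeUncurryFin_curryLeft, ← Nat.cast_smul_eq_nsmul 𝕜]; push_cast; rfl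

lemma compContinuousAlternatingMap_der (g : 𝕜 →L[ℝ] 𝕜') (T : E →L[ℝ] E) (α : Form 𝕜 E k) :
    g.compContinuousAlternatingMap (der T α) = der T (g.compContinuousAlternatingMap α) := by
  ext v; simp [der_apply]

lemma compContinuousAlternatingMap_wedge {g : 𝕜 →L[ℝ] 𝕜'} {ξ : OneForm 𝕜 E} {η : OneForm 𝕜' E}
    (h : ∀ v z, g (ξ v * z) = η v * g z) (α : Form 𝕜 E k) :
    g.compContinuousAlternatingMap (wedge ξ α) = wedge η (g.compContinuousAlternatingMap α) := by
  ext v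
  simp only [wedge_apply, ContinuousLinearMap.compContinuousAlternatingMap_coe,
    Function.comp_apply, _root_.map_sum]
  refine Finset.sum_congr rfl fun i _ => ?_
  rcases Nat.even_or_odd i with hi | hi <;> simp [hi.neg_one_pow, h]

end Calculus

section WeightModules

open Module.End

variable {V : Type*} [AddCommGroup V] [Module ℂ V]

/-- The endomorphisms `X`, `Y`, `H` make `V` a module over `sl(2, ℂ)` on which `H` is
diagonalizable with integral eigenvalues. In contrast to `IsSl2Triple`, the trivial module is
allowed. -/
structure IsSl2Module (X Y H : Module.End ℂ V) : Prop where
  X_Y : ∀ v, X (Y v) = Y (X v) + H v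
  H_X : ∀ v, H (X v) = X (H v) + (2 : ℂ) • X v
  H_Y : ∀ v, H (Y v) = Y (H v) - (2 : ℂ) • Y v
  iSup_eigenspace : ⨆ m : ℤ, eigenspace H (m : ℂ) = ⊤

namespace IsSl2Module

variable {X Y H : Module.End ℂ V}

/-- The highest weight vectors of weight `m`, and zero. -/
def primitive (X H : Module.End ℂ V) (m : ℤ) : Submodule ℂ V :=
  eigenspace H (m : ℂ) ⊓ LinearMap.ker X

lemma mem_primitive {m : ℤ} {v : V} : v ∈ primitive X H m ↔ H v = (m : ℂ) • v ∧ X v = 0 := by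
  simp [primitive]

/-- The sum of the irreducible submodules of highest weight `r`, generated by lowering the highest
weight vectors. -/
def isotypic (X Y H : Module.End ℂ V) (r : ℕ) : Submodule ℂ V :=
  ⨆ i, (primitive X H r).map (Y ^ i)

/-- The Casimir operator `H² + 2 (XY + YX)`, with `XY` replaced by `YX + H`. -/
def casimir (X Y H : Module.End ℂ V) : Module.End ℂ V :=
  (4 : ℂ) • (Y * X) + H * H + (2 : ℂ) • H

lemma casimir_apply (v : V) :
    casimir X Y H v = (4 : ℂ) • Y (X v) + H (H v) + (2 : ℂ) • H v := rfl

lemma symm (h : IsSl2Module X Y H) : IsSl2Module Y X (-H) where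
  X_Y v := by simp [h.X_Y]
  H_X v := by simp [h.H_Y]; abel
  H_Y v := by simp [h.H_X]; abel
  iSup_eigenspace := by
    rw [← h.iSup_eigenspace]
    refine (Equiv.neg ℤ).iSup_congr fun m => ?_
    ext v
    simp [neg_eq_iff_eq_neg]

lemma H_pow_Y (h : IsSl2Module X Y H) {m : ℂ} {v : V} (hv : H v = m • v) (i : ℕ) :
    H ((Y ^ i) v) = (m - 2 * i) • (Y ^ i) v := by
  induction i with
  | zero => simp [hv]
  | succ i ih =>
    rw [pow_succ', Module.End.mul_apply, h.H_Y, ih, map_smul]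
    push_cast
    module

lemma X_pow_Y (h : IsSl2Module X Y H) {m : ℤ} {p : V} (hp : p ∈ primitive X H m) (i : ℕ) :
    X ((Y ^ (i + 1)) p) = ((i + 1 : ℂ) * (m - i)) • (Y ^ i) p := by
  obtain ⟨hH, hX⟩ := mem_primitive.mp hp
  induction i with
  | zero => simp [h.X_Y, hH, hX]
  | succ i ih =>
    rw [pow_succ', Module.End.mul_apply, h.X_Y, ih, map_smul, h.H_pow_Y hH,
      ← Module.End.mul_apply, ← pow_succ']
    push_cast
    module

lemma exists_X_pow_Y_pow (h : IsSl2Module X Y H) {r : ℕ} {p : V} (hp : p ∈ primitive X H r)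
    {i : ℕ} (hi : i ≤ r) : ∃ c : ℂ, c ≠ 0 ∧ (X ^ i) ((Y ^ i) p) = c • p := by
  induction i with
  | zero => exact ⟨1, one_ne_zero, by simp⟩
  | succ i ih =>
    obtain ⟨c, hc, hcp⟩ := ih (by omega)
    refine ⟨(i + 1 : ℂ) * (((r : ℤ) : ℂ) - i) * c,
      mul_ne_zero (mul_ne_zero (Nat.cast_add_one_ne_zero i) ?_) hc, ?_⟩
    · rw [sub_ne_zero]; exact_mod_cast (by omega : r ≠ i)
    · rw [pow_succ, Module.End.mul_apply, h.X_pow_Y hp, map_smul, hcp, smul_smul]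

lemma isotypic_le_eigenspace_casimir (h : IsSl2Module X Y H) (r : ℕ) :
    isotypic X Y H r ≤ eigenspace (casimir X Y H) ((r : ℂ) * (r + 2)) := by
  have commute_Y : Commute (casimir X Y H) Y := by
    ext v
    simp only [Module.End.mul_apply, casimir_apply, map_add, map_sub, map_smul, h.X_Y, h.H_Y]
    module
  refine iSup_le fun i => Submodule.map_le_iff_le_comap.mpr fun p hp => ?_
  obtain ⟨hH, hX⟩ := mem_primitive.mp hp
  rw [Submodule.mem_comap, mem_eigenspace_iff, ← Module.End.mul_apply, commute_Y.pow_right i,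
    Module.End.mul_apply, ← map_smul, casimir_apply, hX, hH, map_smul, hH, map_zero]
  congr 1
  push_cast
  module

lemma pow_Y_mem_isotypic {r : ℕ} {p : V} (hp : p ∈ primitive X H r) (i : ℕ) :
    (Y ^ i) p ∈ isotypic X Y H r :=
  Submodule.mem_iSup_of_mem i (Submodule.mem_map_of_mem hp)

lemma primitive_le_isotypic (r : ℕ) : primitive X H r ≤ isotypic X Y H r :=
  fun _ hp => pow_Y_mem_isotypic hp 0

lemma Y_mem_isotypic {r : ℕ} {v : V} (hv : v ∈ isotypic X Y H r) : Y v ∈ isotypic X Y H r := by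
  suffices isotypic X Y H r ≤ (isotypic X Y H r).comap Y from this hv
  refine iSup_le fun i => Submodule.map_le_iff_le_comap.mpr fun p hp => ?_
  simpa [pow_succ'] using pow_Y_mem_isotypic (Y := Y) hp (i + 1)

lemma X_mem_isotypic (h : IsSl2Module X Y H) {r : ℕ} {v : V} (hv : v ∈ isotypic X Y H r) :
    X v ∈ isotypic X Y H r := by
  suffices isotypic X Y H r ≤ (isotypic X Y H r).comap X from this hv
  refine iSup_le fun i => Submodule.map_le_iff_le_comap.mpr fun p hp => ?_
  cases i with
  | zero => simp [(mem_primitive.mp hp).2]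
  | succ i =>
    simpa only [Submodule.mem_comap, h.X_pow_Y hp] using
      Submodule.smul_mem _ _ (pow_Y_mem_isotypic hp i)

lemma H_mem_isotypic (h : IsSl2Module X Y H) {r : ℕ} {v : V} (hv : v ∈ isotypic X Y H r) :
    H v ∈ isotypic X Y H r := by
  rw [← sub_eq_of_eq_add' (h.X_Y v)]
  exact sub_mem (h.X_mem_isotypic (Y_mem_isotypic hv)) (Y_mem_isotypic (h.X_mem_isotypic hv))

/-- The vectors of weight `m` obtained by lowering highest weight vectors. -/
def loweredPrimitive (X Y H : Module.End ℂ V) (m : ℤ) : Submodule ℂ V :=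
  ⨆ i : ℕ, (primitive X H (m + 2 * i)).map (Y ^ i)

lemma loweredPrimitive_le_eigenspace (h : IsSl2Module X Y H) (m : ℤ) :
    loweredPrimitive X Y H m ≤ eigenspace H (m : ℂ) := by
  refine iSup_le fun i => Submodule.map_le_iff_le_comap.mpr fun p hp => ?_
  rw [Submodule.mem_comap, mem_eigenspace_iff, h.H_pow_Y (mem_primitive.mp hp).1]
  push_cast
  module

lemma loweredPrimitive_add_two_le_map (h : IsSl2Module X Y H) {m : ℤ} (hm : 0 ≤ m) :
    loweredPrimitive X Y H (m + 2) ≤ (loweredPrimitive X Y H m).map X := by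
  refine iSup_le fun i => Submodule.map_le_iff_le_comap.mpr fun p hp => ?_
  rw [show m + 2 + 2 * (i : ℤ) = m + 2 * (i + 1 : ℕ) by push_cast; ring] at hp
  have hc : (i + 1 : ℂ) * ((m + 2 * (i + 1 : ℕ) : ℤ) - i) ≠ 0 :=
    mul_ne_zero (Nat.cast_add_one_ne_zero i) (by
      rw [sub_ne_zero]; exact_mod_cast (by push_cast; omega : m + 2 * (i + 1 : ℕ) ≠ (i : ℤ)))
  rw [← Submodule.smul_mem_iff _ hc, Submodule.mem_comap, map_smul, ← h.X_pow_Y hp]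
  exact Submodule.mem_map_of_mem
    (Submodule.mem_iSup_of_mem (i + 1) (Submodule.mem_map_of_mem hp))

lemma mem_loweredPrimitive (h : IsSl2Module X Y H) {m : ℤ} (hm : 0 ≤ m) {d : ℕ} {v : V}
    (hv : H v = (m : ℂ) • v) (hd : (X ^ d) v = 0) : v ∈ loweredPrimitive X Y H m := by
  induction d generalizing m v with
  | zero => rw [show v = 0 by simpa using hd]; exact zero_mem _
  | succ d ih =>
    have hXv : X v ∈ loweredPrimitive X Y H (m + 2) := by
      refine ih (by omega) ?_ (by rwa [pow_succ] at hd)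
      rw [h.H_X, hv, map_smul]; push_cast; module
    obtain ⟨w, hw, hwv⟩ := h.loweredPrimitive_add_two_le_map hm hXv
    have hvw : v - w ∈ primitive X H m := mem_primitive.mpr
      ⟨by rw [map_sub, hv, mem_eigenspace_iff.mp (h.loweredPrimitive_le_eigenspace m hw), smul_sub],
        by rw [map_sub, hwv, sub_self]⟩
    rw [← sub_add_cancel v w]
    exact add_mem (Submodule.mem_iSup_of_mem 0 ⟨v - w, by simpa using hvw, by simp⟩) hw

/-- The polynomials `∑ᵢ aᵢ tⁱ` of degree at most `N`, encoded as sequences of coefficients, whose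
coefficients are highest weight vectors of weight `m`. -/
def primitivePolynomials (X H : Module.End ℂ V) (m : ℤ) (N : ℕ) : Submodule ℂ (ℕ → V) :=
  Submodule.pi Set.univ fun i => if i ≤ N then primitive X H m else ⊥

lemma mem_primitivePolynomials {m : ℤ} {N : ℕ} {a : ℕ → V} :
    a ∈ primitivePolynomials X H m N ↔
      (∀ i, a i ∈ primitive X H m) ∧ ∀ i, N < i → a i = 0 := by
  simp only [primitivePolynomials, Submodule.mem_pi, Set.mem_univ, forall_const]
  refine ⟨fun h => ⟨fun i => ?_, fun i hi => ?_⟩, fun h i => ?_⟩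
  · have := h i
    split_ifs at this
    exacts [this, (Submodule.mem_bot ℂ).mp this ▸ zero_mem _]
  · simpa [hi.not_ge] using h i
  · split_ifs with hi
    exacts [h.1 i, (Submodule.mem_bot ℂ).mpr (h.2 i (not_le.mp hi))]

/-- The element `∑ᵢ (r - i)! Yⁱ aᵢ` of the isotypic component of highest weight `r` with
coordinates `aᵢ`. The factorials make the wedge product with a one-form act on the coordinates
without numerical factors. -/
def assemble (Y : Module.End ℂ V) (r : ℕ) : (ℕ → V) →ₗ[ℂ] V :=
  ∑ i ∈ Finset.range (r + 1), ((r - i).factorial : ℂ) • (Y ^ i) ∘ₗ LinearMap.proj i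

lemma assemble_apply (r : ℕ) (a : ℕ → V) :
    assemble Y r a = ∑ i ∈ Finset.range (r + 1), ((r - i).factorial : ℂ) • (Y ^ i) (a i) := by
  simp [assemble]

lemma assemble_mem_isotypic {r N : ℕ} {a : ℕ → V} (ha : a ∈ primitivePolynomials X H r N) :
    assemble Y r a ∈ isotypic X Y H r := by
  rw [assemble_apply]
  exact sum_mem fun i _ => Submodule.smul_mem _ _
    (pow_Y_mem_isotypic ((mem_primitivePolynomials.mp ha).1 i) i)

lemma eq_zero_of_assemble_eq_zero (h : IsSl2Module X Y H) {r : ℕ} {a : ℕ → V}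
    (ha : a ∈ primitivePolynomials X H r r) (h0 : assemble Y r a = 0) : a = 0 := by
  rw [mem_primitivePolynomials] at ha
  have weight_injective : Function.Injective fun j : ℕ => (r : ℂ) - 2 * j := fun j l hjl => by
    simpa using hjl
  have term_mem (j : ℕ) : ((r - j).factorial : ℂ) • (Y ^ j) (a j) ∈
      eigenspace H ((r : ℂ) - 2 * j) := by
    refine Submodule.smul_mem _ _ (mem_eigenspace_iff.mpr ?_)
    rw [h.H_pow_Y (mem_primitive.mp (ha.1 j)).1, Int.cast_natCast]
  ext i
  obtain hi | hi := Nat.lt_or_ge r i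
  · exact ha.2 i hi
  have term_eq_zero : ((r - i).factorial : ℂ) • (Y ^ i) (a i) = 0 :=
    (iSupIndep_iff_finsetSum_eq_zero_imp_eq_zero _).mp
      ((eigenspaces_iSupIndep H).comp weight_injective) (Finset.range (r + 1)) _
      (fun j _ => term_mem j) (by rw [← assemble_apply, h0]) i (by simpa using Nat.lt_succ_of_le hi)
  obtain ⟨c, hc, hcp⟩ := h.exists_X_pow_Y_pow (ha.1 i) hi
  rw [smul_eq_zero_iff_right (Nat.cast_ne_zero.mpr (Nat.factorial_ne_zero _))] at term_eq_zero
  rwa [term_eq_zero, map_zero, eq_comm, smul_eq_zero_iff_right hc] at hcp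

section FiniteDimensional

variable [FiniteDimensional ℂ V]

lemma exists_pow_Y_eq_zero (h : IsSl2Module X Y H) {m : ℂ} {v : V} (hv : H v = m • v) :
    ∃ d, (Y ^ d) v = 0 := by
  have weight_injective : Function.Injective fun i : ℕ => m - 2 * i := fun i j hij => by
    simpa using hij
  obtain ⟨d, hd⟩ := (H.finite_hasEigenvalue.preimage weight_injective.injOn).exists_notMem
  by_contra! hne
  exact hd (hasEigenvalue_of_hasEigenvector
    ⟨mem_eigenspace_iff.mpr (h.H_pow_Y hv d), hne d⟩)

lemma eq_zero_of_mem_primitive (h : IsSl2Module X Y H) {m : ℤ} (hm : m < 0) {p : V}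
    (hp : p ∈ primitive X H m) : p = 0 := by
  classical
  have hd := h.exists_pow_Y_eq_zero (mem_primitive.mp hp).1
  obtain ⟨d, hd, d_min⟩ : ∃ d, (Y ^ d) p = 0 ∧ ∀ i < d, (Y ^ i) p ≠ 0 :=
    ⟨Nat.find hd, Nat.find_spec hd, fun _ => Nat.find_min hd⟩
  cases d with
  | zero => simpa using hd
  | succ d =>
    have hc : (d + 1 : ℂ) * (m - d) ≠ 0 := mul_ne_zero (Nat.cast_add_one_ne_zero d)
      (sub_ne_zero.mpr (by exact_mod_cast (by omega : m ≠ (d : ℤ))))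
    have hX := h.X_pow_Y hp d
    rw [hd, map_zero, eq_comm, smul_eq_zero_iff_right hc] at hX
    exact absurd hX (d_min d (Nat.lt_succ_self d))

lemma pow_Y_eq_zero (h : IsSl2Module X Y H) {r i : ℕ} (hi : r < i) {p : V}
    (hp : p ∈ primitive X H r) : (Y ^ i) p = 0 := by
  have h0 : (Y ^ (r + 1)) p = 0 := by
    refine h.eq_zero_of_mem_primitive (m := -r - 2) (by omega) (mem_primitive.mpr ⟨?_, ?_⟩)
    · rw [h.H_pow_Y (mem_primitive.mp hp).1]; push_cast; module
    · rw [h.X_pow_Y hp]; simp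
  rw [← Nat.sub_add_cancel hi, pow_add, Module.End.mul_apply, h0, map_zero]

lemma isotypic_symm_le (h : IsSl2Module X Y H) (r : ℕ) :
    isotypic Y X (-H) r ≤ isotypic X Y H r := by
  refine iSup_le fun i => Submodule.map_le_iff_le_comap.mpr fun p hp => ?_
  have mem : p ∈ isotypic X Y H r := by
    obtain ⟨c, hc, hcp⟩ := h.symm.exists_X_pow_Y_pow hp le_rfl
    rw [← Submodule.smul_mem_iff _ hc, ← hcp]
    refine pow_Y_mem_isotypic (mem_primitive.mpr ⟨?_, ?_⟩) r
    · have := h.symm.H_pow_Y (mem_primitive.mp hp).1 r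
      rw [LinearMap.neg_apply, neg_eq_iff_eq_neg] at this
      rw [this]; push_cast; module
    · rw [← Module.End.mul_apply, ← pow_succ', h.symm.pow_Y_eq_zero (Nat.lt_succ_self r) hp]
  rw [Submodule.mem_comap]
  induction i with
  | zero => exact mem
  | succ i ih => rw [pow_succ']; exact h.X_mem_isotypic ih

lemma eigenspace_le_iSup_isotypic (h : IsSl2Module X Y H) {m : ℤ} (hm : 0 ≤ m) :
    eigenspace H (m : ℂ) ≤ ⨆ r, isotypic X Y H r := by
  intro v hv
  rw [mem_eigenspace_iff] at hv
  obtain ⟨d, hd⟩ := h.symm.exists_pow_Y_eq_zero (m := -m) (v := v) (by simp [hv])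
  refine (iSup_le fun i => ?_ : loweredPrimitive X Y H m ≤ _) (h.mem_loweredPrimitive hm hv hd)
  lift m to ℕ using hm
  exact le_iSup_of_le (m + 2 * i) (le_iSup_of_le i (by push_cast; exact le_rfl))

lemma iSup_isotypic (h : IsSl2Module X Y H) : ⨆ r, isotypic X Y H r = ⊤ := by
  rw [eq_top_iff, ← h.iSup_eigenspace]
  refine iSup_le fun m => ?_
  rcases le_total 0 m with hm | hm
  · exact h.eigenspace_le_iSup_isotypic hm
  · refine le_trans (fun v hv => ?_) ((h.symm.eigenspace_le_iSup_isotypic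
      (neg_nonneg.mpr hm)).trans (iSup_mono h.isotypic_symm_le))
    rw [mem_eigenspace_iff] at hv ⊢
    simp [hv]

lemma injective_casimirEigenvalue : Function.Injective fun r : ℕ => (r : ℂ) * (r + 2) := by
  intro r s hrs
  have : r * (r + 2) = s * (s + 2) := by dsimp only at hrs; exact_mod_cast hrs
  nlinarith

lemma isotypic_eq_eigenspace_casimir (h : IsSl2Module X Y H) (r : ℕ) :
    isotypic X Y H r = eigenspace (casimir X Y H) ((r : ℂ) * (r + 2)) := by
  have indep := (eigenspaces_iSupIndep (casimir X Y H)).comp injective_casimirEigenvalue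
  have codisjoint : isotypic X Y H r ⊔ ⨆ s, ⨆ _ : s ≠ r, isotypic X Y H s = ⊤ := by
    rw [← iSup_split_single, h.iSup_isotypic]
  refine eq_of_le_of_inf_le_of_sup_le (h.isotypic_le_eigenspace_casimir r)
    (z := ⨆ s, ⨆ _ : s ≠ r, isotypic X Y H s) ?_ (codisjoint ▸ le_top)
  exact le_bot_iff.mpr ((indep r).mono_right
    (iSup₂_mono fun s _ => h.isotypic_le_eigenspace_casimir s)).eq_bot |>.trans bot_le

lemma exists_assemble_eq (h : IsSl2Module X Y H) {r : ℕ} {v : V} (hv : v ∈ isotypic X Y H r) :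
    ∃ a ∈ primitivePolynomials X H r r, assemble Y r a = v := by
  suffices isotypic X Y H r ≤ (primitivePolynomials X H r r).map (assemble Y r) from
    Submodule.mem_map.mp (this hv)
  refine iSup_le fun i => Submodule.map_le_iff_le_comap.mpr fun p hp => ?_
  rw [Submodule.mem_comap]
  obtain hi | hi := Nat.lt_or_ge r i
  · rw [h.pow_Y_eq_zero hi hp]; exact zero_mem _
  · refine ⟨Pi.single i (((r - i).factorial : ℂ)⁻¹ • p), mem_primitivePolynomials.mpr
      ⟨fun j => ?_, fun j hj => Pi.single_eq_of_ne (by omega) _⟩, ?_⟩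
    · obtain rfl | hj := eq_or_ne j i
      · simpa using Submodule.smul_mem _ _ hp
      · simp [hj]
    · rw [assemble_apply, Finset.sum_eq_single_of_mem i (by simpa using Nat.lt_succ_of_le hi)
        fun j _ hj => by simp [hj]]
      simp [smul_smul, Nat.factorial_ne_zero]

end FiniteDimensional

end IsSl2Module

end WeightModules

section QuaternionAction

open Module.End

variable {𝕜 𝕜' : Type*} [RCLike 𝕜] [RCLike 𝕜'] {E : Type*} [NormedAddCommGroup E]
  [NormedSpace ℝ E] [Module ℍ[ℝ] E] [IsScalarTower ℝ ℍ[ℝ] E] [ContinuousConstSMul ℍ[ℝ] E] {k : ℕ}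

@[simp] lemma qI_re : qI.re = 0 := rfl
@[simp] lemma qI_imI : qI.imI = 1 := rfl
@[simp] lemma qI_imJ : qI.imJ = 0 := rfl
@[simp] lemma qI_imK : qI.imK = 0 := rfl
@[simp] lemma qJ_re : qJ.re = 0 := rfl
@[simp] lemma qJ_imI : qJ.imI = 0 := rfl
@[simp] lemma qJ_imJ : qJ.imJ = 1 := rfl
@[simp] lemma qJ_imK : qJ.imK = 0 := rfl
@[simp] lemma qK_re : qK.re = 0 := rfl
@[simp] lemma qK_imI : qK.imI = 0 := rfl
@[simp] lemma qK_imJ : qK.imJ = 0 := rfl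
@[simp] lemma qK_imK : qK.imK = 1 := rfl

lemma qI_mul_qI : qI * qI = -1 := by ext <;> simp
lemma qJ_mul_qJ : qJ * qJ = -1 := by ext <;> simp
lemma qK_mul_qK : qK * qK = -1 := by ext <;> simp
lemma qI_mul_qJ : qI * qJ = qK := by ext <;> simp
lemma qJ_mul_qI : qJ * qI = -qK := by ext <;> simp
lemma qJ_mul_qK : qJ * qK = qI := by ext <;> simp
lemma qK_mul_qJ : qK * qJ = -qI := by ext <;> simp
lemma qK_mul_qI : qK * qI = qJ := by ext <;> simp
lemma qI_mul_qK : qI * qK = -qJ := by ext <;> simp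

/-- The derivative of the action of the unit quaternions on forms by pullback, for `E = ℍⁿ` the
action `sp1Action`. -/
def quaternionAct : ℍ[ℝ] →ₗ[ℝ] Form 𝕜 E k →ₗ[𝕜] Form 𝕜 E k where
  toFun q := der (q • ContinuousLinearMap.id ℝ E)
  map_add' p q := by rw [add_smul, map_add]
  map_smul' c q := by rw [smul_assoc, map_smul, RingHom.id_apply]

lemma quaternionAct_wedge (q : ℍ[ℝ]) (ξ : OneForm 𝕜 E) (α : Form 𝕜 E k) :
    quaternionAct q (wedge ξ α)
      = wedge (-(ξ ∘L (q • ContinuousLinearMap.id ℝ E))) α + wedge ξ (quaternionAct q α) :=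
  der_wedge _ ξ α

lemma contr_quaternionAct (q : ℍ[ℝ]) (v : E) (α : Form 𝕜 E (k + 1)) :
    contr v (quaternionAct q α) = quaternionAct q (contr v α) - contr (q • v) α :=
  contr_der _ v α

lemma quaternionAct_zero_form (q : ℍ[ℝ]) (α : Form 𝕜 E 0) : quaternionAct q α = 0 :=
  der_zero_form _ α

lemma quaternionAct_lie {p q s : ℍ[ℝ]} (h : p * q - q * p = s) (α : Form 𝕜 E k) :
    quaternionAct p (quaternionAct q α)
      = quaternionAct q (quaternionAct p α) + quaternionAct s α := by
  rw [← sub_eq_iff_eq_add', ← h]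
  refine (der_lie _ _ α).trans (congrArg (der · α) ?_)
  ext v
  simp [sub_smul, mul_smul]

lemma quaternionAct_qJ_qK (α : Form 𝕜 E k) : quaternionAct qJ (quaternionAct qK α)
    = quaternionAct qK (quaternionAct qJ α) + (2 : ℝ) • quaternionAct qI α := by
  rw [quaternionAct_lie rfl α, qJ_mul_qK, qK_mul_qJ, sub_neg_eq_add, ← two_smul ℝ, map_smul]
  rfl

lemma quaternionAct_qI_qJ (α : Form 𝕜 E k) : quaternionAct qI (quaternionAct qJ α)
    = quaternionAct qJ (quaternionAct qI α) + (2 : ℝ) • quaternionAct qK α := by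
  rw [quaternionAct_lie rfl α, qI_mul_qJ, qJ_mul_qI, sub_neg_eq_add, ← two_smul ℝ, map_smul]
  rfl

lemma quaternionAct_qK_qI (α : Form 𝕜 E k) : quaternionAct qK (quaternionAct qI α)
    = quaternionAct qI (quaternionAct qK α) + (2 : ℝ) • quaternionAct qJ α := by
  rw [quaternionAct_lie rfl α, qK_mul_qI, qI_mul_qK, sub_neg_eq_add, ← two_smul ℝ, map_smul]
  rfl

lemma quaternionAct_of_re_eq_zero {q : ℍ[ℝ]} (hq : q.re = 0) (α : Form 𝕜 E k) :
    quaternionAct q α = q.imI • quaternionAct qI α + q.imJ • quaternionAct qJ α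
      + q.imK • quaternionAct qK α := by
  have h : q = q.imI • qI + q.imJ • qJ + q.imK • qK := by ext <;> simp [hq]
  conv_lhs => rw [h, map_add, map_add, map_smul, map_smul, map_smul]
  rfl

/-- The Cartan element `H = -√-1 I` of `sl(2, ℂ)` acting on forms. -/
def cartan : Module.End ℂ (Form ℂ E k) := (-Complex.I) • quaternionAct qI

/-- The raising operator `X = (J - √-1 K) / 2` on forms. -/
def raising : Module.End ℂ (Form ℂ E k) :=
  (1 / 2 : ℂ) • (quaternionAct qJ - Complex.I • quaternionAct qK)

/-- The lowering operator `Y = -(J + √-1 K) / 2` on forms. -/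
def lowering : Module.End ℂ (Form ℂ E k) :=
  (-1 / 2 : ℂ) • (quaternionAct qJ + Complex.I • quaternionAct qK)

lemma cartan_apply (α : Form ℂ E k) : cartan α = (-Complex.I) • quaternionAct qI α := rfl

lemma raising_apply (α : Form ℂ E k) :
    raising α = (1 / 2 : ℂ) • (quaternionAct qJ α - Complex.I • quaternionAct qK α) := rfl

lemma lowering_apply (α : Form ℂ E k) :
    lowering α = (-1 / 2 : ℂ) • (quaternionAct qJ α + Complex.I • quaternionAct qK α) := rfl

lemma quaternionAct_qI (α : Form ℂ E k) : quaternionAct qI α = Complex.I • cartan α := by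
  rw [cartan_apply, smul_smul]; simp

lemma quaternionAct_qJ (α : Form ℂ E k) : quaternionAct qJ α = raising α - lowering α := by
  rw [raising_apply, lowering_apply]; module

lemma quaternionAct_qK (α : Form ℂ E k) :
    quaternionAct qK α = Complex.I • (raising α + lowering α) := by
  rw [raising_apply, lowering_apply]
  match_scalars <;> ring_nf
  simp

lemma cartan_zero_form (α : Form ℂ E 0) : cartan α = 0 := by
  rw [cartan_apply, quaternionAct_zero_form, smul_zero]

lemma raising_zero_form (α : Form ℂ E 0) : raising α = 0 := by
  rw [raising_apply, quaternionAct_zero_form, quaternionAct_zero_form, smul_zero, sub_zero,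
    smul_zero]

lemma cartan_wedge {c : ℂ} {ξ : OneForm ℂ E} (hξ : ∀ v, Complex.I * ξ (qI • v) = c * ξ v)
    (α : Form ℂ E k) : cartan (wedge ξ α) = c • wedge ξ α + wedge ξ (cartan α) := by
  have h : (-Complex.I) • -(ξ ∘L (qI • ContinuousLinearMap.id ℝ E)) = c • ξ := by
    ext v; simpa using hξ v
  rw [cartan_apply, quaternionAct_wedge, smul_add, ← LinearMap.smul_apply, ← map_smul, h, map_smul,
    LinearMap.smul_apply, cartan_apply, map_smul]

lemma cartan_wedge_mem_iSup_eigenspace {α : Form ℂ E k} {j : ℤ} (hα : cartan α = (j : ℂ) • α)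
    (ξ : OneForm ℂ E) : wedge ξ α ∈ ⨆ m : ℤ, eigenspace (cartan (E := E)) (m : ℂ) := by
  have hII (v : E) : qI • qI • v = -v := by rw [smul_smul, qI_mul_qI, neg_smul, one_smul]
  obtain ⟨ξ', hξ'⟩ : ∃ ξ' : OneForm ℂ E, ∀ v, ξ' v = Complex.I * ξ (qI • v) :=
    ⟨Complex.I • ξ ∘L (qI • ContinuousLinearMap.id ℝ E), fun v => rfl⟩
  have weight_add (v : E) :
      Complex.I * (ξ + ξ') (qI • v) = (1 : ℤ) * (ξ + ξ') v := by
    simp only [_root_.add_apply, hξ', hII, map_neg]; linear_combination (-ξ v) * Complex.I_mul_I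
  have weight_sub (v : E) :
      Complex.I * (ξ - ξ') (qI • v) = (-1 : ℤ) * (ξ - ξ') v := by
    simp only [_root_.sub_apply, hξ', hII, map_neg]; linear_combination ξ v * Complex.I_mul_I
  have mem_of_weight {c : ℤ} {η : OneForm ℂ E} (hη : ∀ v, Complex.I * η (qI • v) = c * η v) :
      wedge η α ∈ ⨆ m : ℤ, eigenspace (cartan (E := E)) (m : ℂ) := by
    refine Submodule.mem_iSup_of_mem (c + j) (mem_eigenspace_iff.mpr ?_)
    rw [cartan_wedge hη, hα, map_smul, Int.cast_add, add_smul]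
  rw [show ξ = (1 / 2 : ℂ) • (ξ + ξ') + (1 / 2 : ℂ) • (ξ - ξ') by module, map_add,
    LinearMap.add_apply, map_smul, map_smul]
  exact add_mem (Submodule.smul_mem _ _ (mem_of_weight weight_add))
    (Submodule.smul_mem _ _ (mem_of_weight weight_sub))

section FiniteDimensional

variable [FiniteDimensional ℝ E]

instance : FiniteDimensional ℂ (Form ℂ E k) := by
  have : FiniteDimensional ℝ (Form ℂ E k) := .of_injective
    (ContinuousMultilinearMap.toMultilinearMapLinear ∘ₗ
      ContinuousAlternatingMap.toContinuousMultilinearMapLinear (R := ℝ))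
    (ContinuousMultilinearMap.toMultilinearMap_injective.comp
      ContinuousAlternatingMap.toContinuousMultilinearMap_injective)
  exact .right ℝ ℂ _

lemma iSup_eigenspace_cartan :
    ⨆ m : ℤ, eigenspace (cartan (E := E) (k := k)) (m : ℂ) = ⊤ := by
  rw [eq_top_iff]
  induction k with
  | zero =>
    refine le_iSup_of_le 0 fun α _ => mem_eigenspace_iff.mpr ?_
    rw [cartan_zero_form, Int.cast_zero, zero_smul]
  | succ k ih =>
    intro α _
    let b := Module.finBasis ℝ E
    have hb := sum_wedge_contr b (fun i => Complex.ofRealCLM ∘L (b.coord i).toContinuousLinearMap)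
      (fun i v => rfl) α
    rw [← Submodule.smul_mem_iff _ (Nat.cast_add_one_ne_zero k : (k + 1 : ℂ) ≠ 0), ← hb]
    refine sum_mem fun i _ => ?_
    suffices ⨆ m : ℤ, eigenspace cartan (m : ℂ) ≤
        (⨆ m : ℤ, eigenspace cartan (m : ℂ)).comap (wedge _) from this (ih trivial)
    exact iSup_le fun m β hβ => cartan_wedge_mem_iSup_eigenspace (mem_eigenspace_iff.mp hβ) _

lemma isSl2Module_form :
    IsSl2Module raising lowering (cartan : Module.End ℂ (Form ℂ E k)) where
  X_Y α := by
    have h := quaternionAct_qJ_qK α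
    simp only [raising_apply, lowering_apply, cartan_apply, map_smul, map_add, map_sub, h]
    match_scalars <;> ring_nf
  H_X α := by
    have h1 := quaternionAct_qI_qJ α
    have h2 := quaternionAct_qK_qI α
    simp only [raising_apply, cartan_apply, map_smul, map_sub, h1, h2]
    match_scalars <;> ring_nf
    simp
  H_Y α := by
    have h1 := quaternionAct_qI_qJ α
    have h2 := quaternionAct_qK_qI α
    simp only [lowering_apply, cartan_apply, map_smul, map_add, h1, h2]
    match_scalars <;> ring_nf
    simp
  iSup_eigenspace := iSup_eigenspace_cartan

end FiniteDimensional

/-- The Casimir operator `I² + J² + K²` on forms. -/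
def quaternionCasimir : Module.End 𝕜 (Form 𝕜 E k) :=
  quaternionAct qI * quaternionAct qI + quaternionAct qJ * quaternionAct qJ
    + quaternionAct qK * quaternionAct qK

lemma quaternionCasimir_apply (α : Form 𝕜 E k) :
    quaternionCasimir α = quaternionAct qI (quaternionAct qI α)
      + quaternionAct qJ (quaternionAct qJ α) + quaternionAct qK (quaternionAct qK α) := rfl

lemma casimir_form (α : Form ℂ E k) :
    IsSl2Module.casimir raising lowering cartan α = -quaternionCasimir α := by
  have h := quaternionAct_qJ_qK α
  simp only [IsSl2Module.casimir_apply, quaternionCasimir_apply, raising_apply, lowering_apply,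
    cartan_apply, map_smul, map_sub, h]
  match_scalars <;> ring_nf <;> simp

variable (𝕜 E k) in
/-- The `k`-forms of type `r`, i.e. the sum of the irreducible `Sp(1)`-representations of highest
weight `r`. As an eigenspace of the Casimir operator it makes sense for real forms as well. -/
def formsOfType (r : ℕ) : Submodule 𝕜 (Form 𝕜 E k) :=
  eigenspace quaternionCasimir ((-(r * (r + 2)) : ℝ) : 𝕜)

variable (𝕜 E k) in
/-- The sum of the `k`-forms of the types other than `r`, the kernel of the projection onto the
forms of type `r`. -/
def formsOfOtherTypes (r : ℕ) : Submodule 𝕜 (Form 𝕜 E k) :=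
  ⨆ s, ⨆ _ : s ≠ r, formsOfType 𝕜 E k s

lemma mem_formsOfType {r : ℕ} {α : Form 𝕜 E k} :
    α ∈ formsOfType 𝕜 E k r ↔ quaternionCasimir α = (-(r * (r + 2)) : ℝ) • α := by
  rw [formsOfType, mem_eigenspace_iff, RCLike.real_smul_eq_coe_smul (K := 𝕜)]

lemma iSupIndep_formsOfType : iSupIndep (formsOfType 𝕜 E k) := by
  refine (eigenspaces_iSupIndep quaternionCasimir).comp
    (f := fun r : ℕ => ((-(r * (r + 2)) : ℝ) : 𝕜)) fun r s hrs => ?_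
  have h : (r * (r + 2) : ℝ) = s * (s + 2) := neg_injective (RCLike.ofReal_injective hrs)
  exact IsSl2Module.injective_casimirEigenvalue (by dsimp only; exact_mod_cast h)

lemma disjoint_formsOfType (r : ℕ) :
    Disjoint (formsOfType 𝕜 E k r) (formsOfOtherTypes 𝕜 E k r) :=
  iSupIndep_formsOfType r

lemma formsOfType_le_formsOfOtherTypes {r s : ℕ} (h : s ≠ r) :
    formsOfType 𝕜 E k s ≤ formsOfOtherTypes 𝕜 E k r :=
  le_iSup₂_of_le s h le_rfl

lemma eq_of_sub_mem_formsOfOtherTypes {r : ℕ} {α β : Form 𝕜 E k}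
    (hα : α ∈ formsOfType 𝕜 E k r) (hβ : β ∈ formsOfType 𝕜 E k r)
    (h : α - β ∈ formsOfOtherTypes 𝕜 E k r) : α = β :=
  sub_eq_zero.mp (Submodule.disjoint_def.mp (disjoint_formsOfType r) _ (sub_mem hα hβ) h)

lemma compContinuousAlternatingMap_mem_formsOfType (g : 𝕜 →L[ℝ] 𝕜') {r : ℕ} {α : Form 𝕜 E k}
    (hα : α ∈ formsOfType 𝕜 E k r) :
    g.compContinuousAlternatingMap α ∈ formsOfType 𝕜' E k r := by
  let G := ContinuousLinearMap.compContinuousAlternatingMapₗ ℝ E 𝕜 𝕜' g (ι := Fin k)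
  have act (q : ℍ[ℝ]) (β : Form 𝕜 E k) : G (quaternionAct q β) = quaternionAct q (G β) :=
    compContinuousAlternatingMap_der g _ β
  rw [mem_formsOfType, quaternionCasimir_apply] at hα ⊢
  have h := congrArg G hα
  simp only [map_add, map_smul, act] at h
  exact h

lemma compContinuousAlternatingMap_mem_iSup_formsOfType (g : 𝕜 →L[ℝ] 𝕜') {ι : Sort*} {f : ι → ℕ}
    {α : Form 𝕜 E k} (hα : α ∈ ⨆ i, formsOfType 𝕜 E k (f i)) :
    g.compContinuousAlternatingMap α ∈ ⨆ i, formsOfType 𝕜' E k (f i) := by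
  suffices (⨆ i, formsOfType 𝕜 E k (f i)).restrictScalars ℝ ≤
      ((⨆ i, formsOfType 𝕜' E k (f i)).restrictScalars ℝ).comap
        (ContinuousLinearMap.compContinuousAlternatingMapₗ ℝ E 𝕜 𝕜' g) from this hα
  rw [Submodule.restrictScalars_iSup]
  exact iSup_le fun i β hβ =>
    Submodule.mem_iSup_of_mem i (compContinuousAlternatingMap_mem_formsOfType g hβ)

lemma compContinuousAlternatingMap_mem_formsOfOtherTypes (g : 𝕜 →L[ℝ] 𝕜') {r : ℕ}
    {α : Form 𝕜 E k} (hα : α ∈ formsOfOtherTypes 𝕜 E k r) :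
    g.compContinuousAlternatingMap α ∈ formsOfOtherTypes 𝕜' E k r := by
  rw [formsOfOtherTypes, iSup_subtype'] at hα ⊢
  exact compContinuousAlternatingMap_mem_iSup_formsOfType g hα

/-- The complexification of a real form. -/
abbrev complexify (α : Form ℝ E k) : Form ℂ E k :=
  Complex.ofRealCLM.compContinuousAlternatingMap α

lemma complexify_mem_formsOfType {r : ℕ} {α : Form ℝ E k} :
    complexify α ∈ formsOfType ℂ E k r ↔ α ∈ formsOfType ℝ E k r :=
  ⟨fun h => compContinuousAlternatingMap_mem_formsOfType Complex.reCLM h,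
    compContinuousAlternatingMap_mem_formsOfType _⟩

lemma complexify_mem_formsOfOtherTypes {r : ℕ} {α : Form ℝ E k} :
    complexify α ∈ formsOfOtherTypes ℂ E k r ↔ α ∈ formsOfOtherTypes ℝ E k r :=
  ⟨fun h => compContinuousAlternatingMap_mem_formsOfOtherTypes Complex.reCLM h,
    compContinuousAlternatingMap_mem_formsOfOtherTypes _⟩

lemma mem_formsOfType_zero {α : Form 𝕜 E k}
    (h : ∀ q : ℍ[ℝ], q.re = 0 → quaternionAct q α = 0) : α ∈ formsOfType 𝕜 E k 0 := by
  rw [mem_formsOfType, quaternionCasimir_apply, h qI rfl, h qJ rfl, h qK rfl]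
  simp

section FiniteDimensional

variable [FiniteDimensional ℝ E]

lemma isotypic_eq_formsOfType (r : ℕ) :
    IsSl2Module.isotypic raising lowering cartan r = formsOfType ℂ E k r := by
  rw [isSl2Module_form.isotypic_eq_eigenspace_casimir]
  ext α
  rw [mem_formsOfType, mem_eigenspace_iff, casimir_form, neg_eq_iff_eq_neg, neg_smul,
    ← Complex.coe_smul]
  push_cast
  rfl

lemma isCompl_formsOfType (r : ℕ) :
    IsCompl (formsOfType ℝ E k r) (formsOfOtherTypes ℝ E k r) := by
  refine ⟨disjoint_formsOfType r, codisjoint_iff.mpr ?_⟩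
  rw [formsOfOtherTypes, ← iSup_split_single, eq_top_iff]
  intro α _
  refine compContinuousAlternatingMap_mem_iSup_formsOfType Complex.reCLM (α := complexify α) ?_
  simp only [← isotypic_eq_formsOfType, isSl2Module_form.iSup_isotypic, Submodule.mem_top]

lemma quaternionAct_mem_formsOfType {r : ℕ} {α : Form ℂ E k} (hα : α ∈ formsOfType ℂ E k r)
    {q : ℍ[ℝ]} (hq : q.re = 0) : quaternionAct q α ∈ formsOfType ℂ E k r := by
  rw [← isotypic_eq_formsOfType] at hα ⊢
  have hX := isSl2Module_form.X_mem_isotypic hα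
  have hY := IsSl2Module.Y_mem_isotypic hα
  have hH := isSl2Module_form.H_mem_isotypic hα
  rw [quaternionAct_of_re_eq_zero hq, quaternionAct_qI, quaternionAct_qJ, quaternionAct_qK]
  simp only [← Complex.coe_smul]
  exact add_mem (add_mem (Submodule.smul_mem _ _ (Submodule.smul_mem _ _ hH))
    (Submodule.smul_mem _ _ (sub_mem hX hY)))
    (Submodule.smul_mem _ _ (Submodule.smul_mem _ _ (add_mem hX hY)))

lemma quaternionAct_eq_zero {α : Form ℝ E k} (hα : α ∈ formsOfType ℝ E k 0) {q : ℍ[ℝ]}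
    (hq : q.re = 0) : quaternionAct q α = 0 := by
  have hβ := complexify_mem_formsOfType.mpr hα
  rw [← isotypic_eq_formsOfType] at hβ
  obtain ⟨a, ha, hαa⟩ := isSl2Module_form.exists_assemble_eq hβ
  have ha0 : complexify α = a 0 := by simp [← hαa, IsSl2Module.assemble_apply]
  have ha0_mem := (IsSl2Module.mem_primitivePolynomials.mp ha).1 0
  obtain ⟨hH, hX⟩ := IsSl2Module.mem_primitive.mp ha0_mem
  have hY : lowering (a 0) = 0 := by
    simpa using isSl2Module_form.pow_Y_eq_zero (zero_lt_one (α := ℕ)) ha0_mem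
  have h : quaternionAct q (complexify α) = 0 := by
    rw [ha0, quaternionAct_of_re_eq_zero hq, quaternionAct_qI, quaternionAct_qJ, quaternionAct_qK,
      hY, hX, hH]
    simp
  calc quaternionAct q α
      = Complex.reCLM.compContinuousAlternatingMap (quaternionAct q (complexify α)) :=
        (compContinuousAlternatingMap_der Complex.reCLM _ (complexify α)).symm
    _ = 0 := by rw [h]; rfl

end FiniteDimensional

end QuaternionAction

section Pencil

variable {E : Type*} [NormedAddCommGroup E] [NormedSpace ℝ E] {k : ℕ}

/-- The coefficients of the product `(e₁ + t e₂) ∧ ∑ᵢ aᵢ tⁱ`. -/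
def wedgePencil (e₁ e₂ : OneForm ℂ E) (a : ℕ → Form ℂ E k) : ℕ → Form ℂ E (k + 1)
  | 0 => wedge e₁ (a 0)
  | i + 1 => wedge e₁ (a (i + 1)) + wedge e₂ (a i)

lemma wedgePencil_wedgePencil (e₁ e₂ : OneForm ℂ E) (a : ℕ → Form ℂ E k) :
    wedgePencil e₁ e₂ (wedgePencil e₁ e₂ a) = 0 := by
  ext1 i
  rcases i with _ | _ | i <;>
    simp [wedgePencil, wedge_self, wedge_wedge_comm e₂ e₁]

end Pencil

section WeightOne

open IsSl2Module

variable {E : Type*} [NormedAddCommGroup E] [NormedSpace ℝ E] [Module ℍ[ℝ] E] {k : ℕ}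
  {e : OneForm ℂ E}

/-- The one-form `e` has weight `1`, i.e. it is a highest weight vector. -/
def HasWeightOne (e : OneForm ℂ E) : Prop := ∀ v, Complex.I * e (qI • v) = e v

/-- The contraction with the vector `(v + √-1 I v) / 2` of weight `-1`. -/
def contrLower (v : E) : Form ℂ E (k + 1) →ₗ[ℂ] Form ℂ E k :=
  (1 / 2 : ℂ) • (contr v + Complex.I • contr (qI • v))

/-- The contraction with the vector `(-J v + √-1 K v) / 2` of weight `1`. -/
def contrRaise (v : E) : Form ℂ E (k + 1) →ₗ[ℂ] Form ℂ E k :=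
  (1 / 2 : ℂ) • (Complex.I • contr (qK • v) - contr (qJ • v))

lemma contrLower_apply (v : E) (α : Form ℂ E (k + 1)) :
    contrLower v α = (1 / 2 : ℂ) • (contr v α + Complex.I • contr (qI • v) α) := rfl

lemma contrRaise_apply (v : E) (α : Form ℂ E (k + 1)) :
    contrRaise v α = (1 / 2 : ℂ) • (Complex.I • contr (qK • v) α - contr (qJ • v) α) := rfl

lemma contrRaise_self (v : E) (α : Form ℂ E (k + 2)) : contrRaise v (contrRaise v α) = 0 := by
  simp only [contrRaise_apply, map_sub, map_smul, contr_self, contr_contr_comm (qK • v) (qJ • v)]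
  module

namespace HasWeightOne

lemma apply_qI_smul (he : HasWeightOne e) (v : E) : e (qI • v) = -Complex.I * e v := by
  linear_combination -Complex.I * he v + e (qI • v) * Complex.I_mul_I

lemma apply_qK_smul (he : HasWeightOne e) (v : E) : e (qK • v) = -Complex.I * e (qJ • v) := by
  rw [← he.apply_qI_smul, smul_smul, qI_mul_qJ]

lemma contrLower_wedge (he : HasWeightOne e) (v : E) (α : Form ℂ E (k + 1)) :
    contrLower v (wedge e α) = e v • α - wedge e (contrLower v α) := by
  simp only [contrLower_apply, contr_wedge, smul_sub, smul_smul, he v, map_smul, map_add]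
  module

lemma contrLower_wedge_zero (he : HasWeightOne e) (v : E) (α : Form ℂ E 0) :
    contrLower v (wedge e α) = e v • α := by
  simp only [contrLower_apply, contr_wedge_zero, smul_smul, he v]
  module

lemma contrRaise_wedge (he : HasWeightOne e) (v : E) (α : Form ℂ E (k + 1)) :
    contrRaise v (wedge e α) = -wedge e (contrRaise v α) := by
  have h : Complex.I * e (qK • v) = e (qJ • v) := by rw [← qI_mul_qJ, mul_smul, he]
  simp only [contrRaise_apply, contr_wedge, smul_sub, smul_smul, h, map_smul, map_sub]
  module

lemma wedge_contrLower (he : HasWeightOne e) {v : E} (hv : e v = 1) {p : Form ℂ E (k + 1)}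
    (hp : wedge e p = 0) : wedge e (contrLower v p) = p := by
  have h := he.contrLower_wedge v p
  rw [hp, map_zero, hv, one_smul] at h
  exact (sub_eq_zero.mp h.symm).symm

lemma wedge_contrLower_eq_zero (he : HasWeightOne e) {v : E} (hv : e v = 0)
    {p : Form ℂ E (k + 1)} (hp : wedge e p = 0) : wedge e (contrLower v p) = 0 := by
  simpa [hp, hv] using he.contrLower_wedge v p

lemma wedge_contrRaise (he : HasWeightOne e) (v : E) {p : Form ℂ E (k + 1)}
    (hp : wedge e p = 0) : wedge e (contrRaise v p) = 0 := by
  simpa [hp] using he.contrRaise_wedge v p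

end HasWeightOne

/-- The one-forms `e₁` and `e₂` of weight `1` are linearly independent, as witnessed by vectors. -/
structure IsWeightOnePair (e₁ e₂ : OneForm ℂ E) : Prop where
  left : HasWeightOne e₁
  right : HasWeightOne e₂
  exists_dual_left : ∃ v, e₁ v = 1 ∧ e₂ v = 0
  exists_dual_right : ∃ v, e₂ v = 1

namespace IsWeightOnePair

lemma eq_zero_of_wedge_wedge_eq_zero {e₁ e₂ : OneForm ℂ E}
    (h : IsWeightOnePair e₁ e₂) {α : Form ℂ E 0}
    (hα : wedge e₂ (wedge e₁ α) = 0) : α = 0 := by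
  obtain ⟨v, hv₁, hv₂⟩ := h.exists_dual_left
  obtain ⟨w, hw⟩ := h.exists_dual_right
  have he₂ : wedge e₂ α = 0 := by
    simpa [h.right.contrLower_wedge, h.left.contrLower_wedge_zero, hv₁, hv₂] using
      congrArg (contrLower v) hα
  simpa [h.right.contrLower_wedge_zero, hw] using congrArg (contrLower w) he₂

end IsWeightOnePair

variable [IsScalarTower ℝ ℍ[ℝ] E] [ContinuousConstSMul ℍ[ℝ] E]

/-- The one-form `Y e` of weight `-1` that spans with the one-form `e` of weight `1` an irreducible
representation. -/
def partner (e : OneForm ℂ E) : OneForm ℂ E := e ∘L (qJ • ContinuousLinearMap.id ℝ E)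

lemma partner_apply (e : OneForm ℂ E) (v : E) : partner e v = e (qJ • v) := rfl

namespace HasWeightOne

lemma cartan_wedge (he : HasWeightOne e) (α : Form ℂ E k) :
    cartan (wedge e α) = wedge e α + wedge e (cartan α) := by
  rw [QuaternionicForms.cartan_wedge (c := 1) (fun v => by rw [he v, one_mul]), one_smul]

lemma cartan_wedge_partner (he : HasWeightOne e) (α : Form ℂ E k) :
    cartan (wedge (partner e) α) = -wedge (partner e) α + wedge (partner e) (cartan α) := by
  rw [QuaternionicForms.cartan_wedge (c := -1), neg_one_smul]
  intro v
  rw [partner_apply, partner_apply, smul_smul, qJ_mul_qI, neg_smul, map_neg, he.apply_qK_smul]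
  linear_combination e (qJ • v) * Complex.I_mul_I

end HasWeightOne

lemma raising_wedge {ξ η : OneForm ℂ E}
    (h : ∀ v, Complex.I * ξ (qK • v) - ξ (qJ • v) = 2 * η v) (α : Form ℂ E k) :
    raising (wedge ξ α) = wedge η α + wedge ξ (raising α) := by
  have hη : η = (1 / 2 : ℂ) • (-(ξ ∘L (qJ • ContinuousLinearMap.id ℝ E))
      - Complex.I • -(ξ ∘L (qK • ContinuousLinearMap.id ℝ E))) := by
    ext v; simp; linear_combination (-1 / 2 : ℂ) * h v
  simp only [raising_apply, quaternionAct_wedge, hη, map_smul, map_sub, LinearMap.smul_apply,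
    LinearMap.sub_apply]
  module

lemma lowering_wedge {ξ η : OneForm ℂ E}
    (h : ∀ v, Complex.I * ξ (qK • v) + ξ (qJ • v) = 2 * η v) (α : Form ℂ E k) :
    lowering (wedge ξ α) = wedge η α + wedge ξ (lowering α) := by
  have hη : η = (-1 / 2 : ℂ) • (-(ξ ∘L (qJ • ContinuousLinearMap.id ℝ E))
      + Complex.I • -(ξ ∘L (qK • ContinuousLinearMap.id ℝ E))) := by
    ext v; simp; linear_combination (-1 / 2 : ℂ) * h v
  simp only [lowering_apply, quaternionAct_wedge, hη, map_smul, map_add, LinearMap.smul_apply,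
    LinearMap.add_apply]
  module

namespace HasWeightOne

lemma raising_wedge (he : HasWeightOne e) (α : Form ℂ E k) :
    raising (wedge e α) = wedge e (raising α) := by
  rw [QuaternionicForms.raising_wedge (η := 0), map_zero, LinearMap.zero_apply, zero_add]
  intro v
  rw [he.apply_qK_smul, _root_.zero_apply]
  linear_combination -e (qJ • v) * Complex.I_mul_I

lemma lowering_wedge (he : HasWeightOne e) (α : Form ℂ E k) :
    lowering (wedge e α) = wedge (partner e) α + wedge e (lowering α) := by
  refine QuaternionicForms.lowering_wedge (fun v => ?_) α
  rw [he.apply_qK_smul, partner_apply]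
  linear_combination -e (qJ • v) * Complex.I_mul_I

lemma raising_wedge_partner (he : HasWeightOne e) (α : Form ℂ E k) :
    raising (wedge (partner e) α) = wedge e α + wedge (partner e) (raising α) := by
  refine QuaternionicForms.raising_wedge (fun v => ?_) α
  rw [partner_apply, partner_apply, smul_smul, smul_smul, qJ_mul_qK, qJ_mul_qJ, neg_one_smul,
    map_neg, he.apply_qI_smul]
  linear_combination -e v * Complex.I_mul_I

lemma lowering_wedge_partner (he : HasWeightOne e) (α : Form ℂ E k) :
    lowering (wedge (partner e) α) = wedge (partner e) (lowering α) := by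
  rw [QuaternionicForms.lowering_wedge (η := 0), map_zero, LinearMap.zero_apply, zero_add]
  intro v
  rw [partner_apply, partner_apply, smul_smul, smul_smul, qJ_mul_qK, qJ_mul_qJ, neg_one_smul,
    map_neg, he.apply_qI_smul, _root_.zero_apply]
  linear_combination -e v * Complex.I_mul_I

end HasWeightOne

lemma quaternionAct_contr (q : ℍ[ℝ]) (v : E) (α : Form ℂ E (k + 1)) :
    quaternionAct q (contr v α) = contr v (quaternionAct q α) + contr (q • v) α := by
  rw [contr_quaternionAct, sub_add_cancel]

lemma cartan_contrLower (v : E) (α : Form ℂ E (k + 1)) :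
    cartan (contrLower v α) = contrLower v (cartan α) - contrLower v α := by
  simp only [contrLower_apply, cartan_apply, map_add, map_smul, quaternionAct_contr, smul_smul,
    qI_mul_qI, neg_smul, one_smul, map_neg, LinearMap.neg_apply]
  match_scalars <;> ring_nf
  simp
  norm_num

lemma raising_contrLower (v : E) (α : Form ℂ E (k + 1)) :
    raising (contrLower v α) = contrLower v (raising α) - contrRaise v α := by
  simp only [contrLower_apply, contrRaise_apply, raising_apply, map_add, map_sub, map_smul,
    quaternionAct_contr, smul_smul, qJ_mul_qI, qK_mul_qI, neg_smul, map_neg, LinearMap.neg_apply]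
  match_scalars <;> ring_nf
  simp
  norm_num

lemma cartan_contrRaise (v : E) (α : Form ℂ E (k + 1)) :
    cartan (contrRaise v α) = contrRaise v (cartan α) + contrRaise v α := by
  simp only [contrRaise_apply, cartan_apply, map_sub, map_smul, quaternionAct_contr, smul_smul,
    qI_mul_qJ, qI_mul_qK, neg_smul, map_neg, LinearMap.neg_apply]
  match_scalars <;> ring_nf
  simp
  norm_num

lemma raising_contrRaise (v : E) (α : Form ℂ E (k + 1)) :
    raising (contrRaise v α) = contrRaise v (raising α) := by
  simp only [contrRaise_apply, raising_apply, map_sub, map_smul, quaternionAct_contr, smul_smul,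
    qJ_mul_qJ, qJ_mul_qK, qK_mul_qJ, qK_mul_qK, neg_smul, one_smul, map_neg, LinearMap.neg_apply]
  match_scalars <;> ring_nf
  simp

variable (E k) in
/-- The complex `k`-forms that are highest weight vectors of weight `r`. -/
abbrev primitiveForms (r : ℤ) : Submodule ℂ (Form ℂ E k) := primitive raising cartan r

lemma mem_primitiveForms {r : ℤ} {p : Form ℂ E k} :
    p ∈ primitiveForms E k r ↔ cartan p = (r : ℂ) • p ∧ raising p = 0 := mem_primitive

lemma eq_zero_of_mem_primitiveForms_zero {r : ℤ} (hr : r ≠ 0) {p : Form ℂ E 0}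
    (hp : p ∈ primitiveForms E 0 r) : p = 0 := by
  have h := (mem_primitiveForms.mp hp).1
  rw [cartan_zero_form, eq_comm, smul_eq_zero] at h
  exact h.resolve_left (Int.cast_ne_zero.mpr hr)

lemma contrLower_contrRaise_mem_primitiveForms (v : E) {r : ℤ} {p : Form ℂ E (k + 2)}
    (hp : p ∈ primitiveForms E (k + 2) r) :
    contrLower v (contrRaise v p) ∈ primitiveForms E k r := by
  rw [mem_primitiveForms] at hp ⊢
  constructor
  · rw [cartan_contrLower, cartan_contrRaise, hp.1]
    simp only [map_add, map_smul]
    abel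
  · rw [raising_contrLower, raising_contrRaise, hp.2, contrRaise_self]
    simp

namespace HasWeightOne

lemma wedge_mem_primitiveForms (he : HasWeightOne e) {r : ℤ} {p : Form ℂ E k}
    (hp : p ∈ primitiveForms E k r) : wedge e p ∈ primitiveForms E (k + 1) (r + 1) := by
  rw [mem_primitiveForms] at hp ⊢
  refine ⟨?_, by rw [he.raising_wedge, hp.2, map_zero]⟩
  rw [he.cartan_wedge, hp.1, map_smul]
  push_cast
  module

variable [FiniteDimensional ℝ E]

lemma wedge_partner_sub_mem_primitiveForms (he : HasWeightOne e) {r : ℤ} (hr : r + 1 ≠ 0)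
    {p : Form ℂ E k} (hp : p ∈ primitiveForms E k r) :
    wedge (partner e) p - ((r : ℂ) + 1)⁻¹ • lowering (wedge e p)
      ∈ primitiveForms E (k + 1) (r - 1) := by
  obtain ⟨hep_cartan, hep_raising⟩ := mem_primitiveForms.mp (he.wedge_mem_primitiveForms hp)
  rw [mem_primitiveForms] at hp ⊢
  constructor
  · rw [map_sub, map_smul, isSl2Module_form.H_Y, hep_cartan, he.cartan_wedge_partner, hp.1,
      map_smul, map_smul]
    push_cast
    module
  · rw [map_sub, map_smul, isSl2Module_form.X_Y, hep_cartan, hep_raising,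
      he.raising_wedge_partner, hp.2, map_zero, map_zero, zero_add, add_zero, smul_smul]
    push_cast
    rw [inv_mul_cancel₀ (by exact_mod_cast hr), one_smul, sub_self]

lemma contrLower_add_mem_primitiveForms (he : HasWeightOne e) {v : E} (hv : e v = 1) {r : ℤ}
    (hr : r + 1 ≠ 0) {p : Form ℂ E (k + 2)} (hp : p ∈ primitiveForms E (k + 2) (r + 1))
    (hep : wedge e p = 0) :
    contrLower v p + ((r : ℂ) + 1)⁻¹ • wedge e (lowering (contrLower v (contrRaise v p)))
      ∈ primitiveForms E (k + 1) r := by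
  obtain ⟨hg_cartan, hg_raising⟩ :=
    mem_primitiveForms.mp (contrLower_contrRaise_mem_primitiveForms v hp)
  rw [mem_primitiveForms] at hp ⊢
  constructor
  · rw [map_add, map_smul, cartan_contrLower, hp.1, he.cartan_wedge, isSl2Module_form.H_Y,
      hg_cartan]
    simp only [map_sub, map_smul]
    push_cast
    module
  · rw [map_add, map_smul, raising_contrLower, hp.2, he.raising_wedge, isSl2Module_form.X_Y,
      hg_cartan, hg_raising, map_zero, map_zero, zero_add, map_smul, smul_smul,
      he.wedge_contrLower hv (he.wedge_contrRaise v hep)]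
    push_cast
    rw [inv_mul_cancel₀ (by exact_mod_cast hr), one_smul, zero_sub, neg_add_cancel]

lemma exists_wedge_eq (he : HasWeightOne e) {v : E} (hv : e v = 1) {r : ℤ} (hr : r + 1 ≠ 0)
    {p : Form ℂ E (k + 1)} (hp : p ∈ primitiveForms E (k + 1) (r + 1)) (hep : wedge e p = 0) :
    ∃ q ∈ primitiveForms E k r, wedge e q = p := by
  rcases k with _ | k
  · refine ⟨contrLower v p, mem_primitiveForms.mpr ⟨?_, raising_zero_form _⟩,
      he.wedge_contrLower hv hep⟩
    rw [cartan_contrLower, (mem_primitiveForms.mp hp).1, map_smul]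
    push_cast
    module
  · refine ⟨_, he.contrLower_add_mem_primitiveForms hv hr hp hep, ?_⟩
    rw [map_add, map_smul, wedge_self, smul_zero, add_zero, he.wedge_contrLower hv hep]

lemma exists_wedge_wedge_eq_smul (he : HasWeightOne e) {v : E} (hv : e v = 1) (e' : OneForm ℂ E)
    {r : ℤ} (hr : 0 ≤ r) {g : Form ℂ E k}
    (hg : g ∈ primitiveForms E k (r + 1 + 1)) (heg : wedge e g = 0) :
    ∃ t ∈ primitiveForms E k r, wedge e (wedge e' t) =
      (((r : ℂ) + 1) / (r + 1 + 1)) • wedge e (wedge e' (lowering g)) := by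
  have hr2 : (r : ℂ) + 1 + 1 ≠ 0 := by exact_mod_cast (by omega : r + 1 + 1 ≠ 0)
  rcases k with _ | k
  · exact ⟨0, zero_mem _, by simp [eq_zero_of_mem_primitiveForms_zero (by omega) hg]⟩
  obtain ⟨s, hs, rfl⟩ := he.exists_wedge_eq hv (by omega) hg heg
  refine ⟨_, by simpa using he.wedge_partner_sub_mem_primitiveForms (by omega) hs, ?_⟩
  have wedge_wedge_self (β : Form ℂ E k) : wedge e (wedge e' (wedge e β)) = 0 := by
    rw [wedge_wedge_comm, wedge_self, map_zero, neg_zero]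
  simp only [he.lowering_wedge, map_sub, map_add, map_smul, wedge_wedge_self, add_zero]
  match_scalars
  field_simp
  ring

end HasWeightOne

namespace IsWeightOnePair

variable {e₁ e₂ : OneForm ℂ E}

lemma wedgePencil_mem (h : IsWeightOnePair e₁ e₂) {r : ℤ} {N : ℕ} {a : ℕ → Form ℂ E k}
    (ha : a ∈ primitivePolynomials raising cartan r N) :
    wedgePencil e₁ e₂ a ∈ primitivePolynomials raising cartan (r + 1) (N + 1) := by
  rw [mem_primitivePolynomials] at ha ⊢
  refine ⟨fun i => ?_, fun i hi => ?_⟩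
  · rcases i with _ | i
    · exact h.left.wedge_mem_primitiveForms (ha.1 0)
    · exact add_mem (h.left.wedge_mem_primitiveForms (ha.1 _))
        (h.right.wedge_mem_primitiveForms (ha.1 i))
  · rcases i with _ | i
    · omega
    · simp [wedgePencil, ha.2 i (by omega), ha.2 (i + 1) (by omega)]

variable [FiniteDimensional ℝ E]

lemma exists_wedge_eq (h : IsWeightOnePair e₁ e₂) {r : ℤ} (hr : 0 ≤ r) {p : Form ℂ E (k + 2)}
    (hp : p ∈ primitiveForms E (k + 2) (r + 1 + 1)) (h₁ : wedge e₁ p = 0) (h₂ : wedge e₂ p = 0) :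
    ∃ q ∈ primitiveForms E (k + 1) (r + 1), wedge e₁ q = p ∧ wedge e₂ q = 0 := by
  obtain ⟨v, hv₁, hv₂⟩ := h.exists_dual_left
  obtain ⟨w, hw⟩ := h.exists_dual_right
  have hr1 : (r : ℂ) + 1 ≠ 0 := by exact_mod_cast (by omega : r + 1 ≠ 0)
  have hr2 : (r : ℂ) + 1 + 1 ≠ 0 := by exact_mod_cast (by omega : r + 1 + 1 ≠ 0)
  set g := contrLower v (contrRaise v p) with hg
  obtain ⟨t, ht, ht_eq⟩ := h.right.exists_wedge_wedge_eq_smul hw e₁ hr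
    (contrLower_contrRaise_mem_primitiveForms v hp)
    (h.right.wedge_contrLower_eq_zero hv₂ (h.right.wedge_contrRaise v h₂))
  refine ⟨_, sub_mem (h.left.contrLower_add_mem_primitiveForms hv₁ (by omega) hp h₁)
    (Submodule.smul_mem _ ((r : ℂ) + 1)⁻¹ (h.left.wedge_mem_primitiveForms ht)), ?_, ?_⟩
  · simp only [map_sub, map_add, map_smul, wedge_self, smul_zero, add_zero, sub_zero]
    exact h.left.wedge_contrLower hv₁ h₁
  · simp only [map_sub, map_add, map_smul, h.right.wedge_contrLower_eq_zero hv₂ h₂, ht_eq, ← hg]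
    push_cast
    match_scalars
    field_simp
    ring

lemma exists_wedge_wedge_eq (h : IsWeightOnePair e₁ e₂) {r : ℤ} (hr : 0 ≤ r)
    {p : Form ℂ E (k + 2)} (hp : p ∈ primitiveForms E (k + 2) (r + 1 + 1))
    (h₁ : wedge e₁ p = 0) (h₂ : wedge e₂ p = 0) :
    ∃ u ∈ primitiveForms E k r, wedge e₁ (wedge e₂ u) = p := by
  obtain ⟨w, hw⟩ := h.exists_dual_right
  obtain ⟨q, hq, rfl, hq₂⟩ := h.exists_wedge_eq hr hp h₁ h₂
  obtain ⟨u, hu, rfl⟩ := h.right.exists_wedge_eq hw (by omega) hq hq₂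
  exact ⟨u, hu, rfl⟩

lemma exists_wedge_eq_zero_wedge_eq (h : IsWeightOnePair e₁ e₂) {r : ℤ} (hkr : k = 0 ∨ 0 < r)
    {p : Form ℂ E k} (hp : p ∈ primitiveForms E k r) (h0 : wedge e₂ (wedge e₁ p) = 0) :
    ∃ z ∈ primitiveForms E k r, wedge e₁ z = 0 ∧ wedge e₂ z = wedge e₁ p := by
  rcases k with _ | k
  · exact ⟨0, zero_mem _, by simp [h.eq_zero_of_wedge_wedge_eq_zero h0]⟩
  obtain ⟨r, rfl⟩ : ∃ s, r = s + 1 := ⟨r - 1, by ring⟩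
  obtain ⟨u, hu, hup⟩ := h.exists_wedge_wedge_eq (by omega) (h.left.wedge_mem_primitiveForms hp)
    (wedge_self _ _) h0
  refine ⟨-wedge e₁ u, neg_mem (h.left.wedge_mem_primitiveForms hu), ?_, ?_⟩
  · rw [map_neg, wedge_self, neg_zero]
  · rw [map_neg, wedge_wedge_comm, neg_neg, hup]

lemma exists_wedge_eq_wedge_eq (h : IsWeightOnePair e₁ e₂) {r : ℤ} (hr : 0 ≤ r)
    (hkr : k = 0 ∨ 0 < r) {p q : Form ℂ E (k + 1)} (hp : p ∈ primitiveForms E (k + 1) (r + 1))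
    (hq : q ∈ primitiveForms E (k + 1) (r + 1)) (h₁ : wedge e₁ p = 0)
    (h₁₂ : wedge e₁ q + wedge e₂ p = 0) (h₂ : wedge e₂ q = 0) :
    ∃ b ∈ primitiveForms E k r, wedge e₁ b = p ∧ wedge e₂ b = q := by
  obtain ⟨v, hv, -⟩ := h.exists_dual_left
  obtain ⟨g, hg, rfl⟩ := h.left.exists_wedge_eq hv (by omega) hp h₁
  obtain ⟨c, hc, hcq⟩ := h.left.exists_wedge_eq hv (by omega)
    (sub_mem hq (h.right.wedge_mem_primitiveForms hg))
    (by rw [map_sub, wedge_wedge_comm e₁ e₂, sub_neg_eq_add, h₁₂])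
  obtain ⟨z, hz, hz₁, hz₂⟩ := h.exists_wedge_eq_zero_wedge_eq hkr hc
    (by rw [hcq, map_sub, h₂, wedge_self, sub_zero])
  exact ⟨g + z, add_mem hg hz, by rw [map_add, hz₁, add_zero],
    by rw [map_add, hz₂, hcq, add_sub_cancel]⟩

lemma exists_wedgePencil_eq (h : IsWeightOnePair e₁ e₂) {r : ℤ}
    (hr : 0 ≤ r) (hkr : k = 0 ∨ 0 < r) {N : ℕ} {a : ℕ → Form ℂ E (k + 1)}
    (ha : a ∈ primitivePolynomials raising cartan (r + 1) (N + 1))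
    (h0 : ∀ i, wedgePencil e₁ e₂ a i = 0) :
    ∃ b ∈ primitivePolynomials raising cartan r N, wedgePencil e₁ e₂ b = a := by
  simp only [mem_primitivePolynomials] at ha ⊢
  induction N generalizing a with
  | zero =>
    obtain ⟨b, hb, hb₁, hb₂⟩ := h.exists_wedge_eq_wedge_eq hr hkr (ha.1 0) (ha.1 1) (h0 0)
      (h0 1) (by simpa [wedgePencil, ha.2 2 (by omega)] using h0 2)
    refine ⟨Pi.single 0 b, ⟨fun i => ?_, fun i hi => Pi.single_eq_of_ne hi.ne' _⟩, ?_⟩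
    · rcases i with _ | i <;> simp [hb]
    · ext1 i
      rcases i with _ | _ | i <;> simp [wedgePencil, hb₁, hb₂, ha.2]
  | succ N ih =>
    obtain ⟨v, hv, -⟩ := h.exists_dual_left
    obtain ⟨b₀, hb₀, hb₀a⟩ := h.left.exists_wedge_eq hv (by omega) (ha.1 0) (h0 0)
    let a' : ℕ → Form ℂ E (k + 1) := fun i => Nat.casesOn i (a 1 - wedge e₂ b₀) fun i => a (i + 2)
    have mem : ∀ i, a' i ∈ primitiveForms E (k + 1) (r + 1) := by
      rintro (_ | i)
      exacts [sub_mem (ha.1 1) (h.right.wedge_mem_primitiveForms hb₀), ha.1 _]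
    have degree_le : ∀ i, N + 1 < i → a' i = 0 := by
      rintro (_ | i) hi
      exacts [absurd hi (Nat.not_lt_zero _), ha.2 _ (by omega)]
    have closed : ∀ i, wedgePencil e₁ e₂ a' i = 0 := by
      rintro (_ | _ | i)
      · simpa [a', wedgePencil, wedge_wedge_comm e₁ e₂, hb₀a] using h0 1
      · simpa [a', wedgePencil, wedge_self] using h0 2
      · exact h0 (i + 3)
    obtain ⟨b, hb, hba⟩ := ih closed ⟨mem, degree_le⟩
    refine ⟨fun i => Nat.casesOn i b₀ b, ⟨?_, ?_⟩, ?_⟩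
    · rintro (_ | i)
      exacts [hb₀, hb.1 i]
    · rintro (_ | i) hi
      exacts [absurd hi (Nat.not_lt_zero _), hb.2 i (by omega)]
    · ext1 (_ | _ | i)
      exacts [hb₀a, eq_sub_iff_add_eq.mp (congrFun hba 0), congrFun hba (i + 1)]

end IsWeightOnePair

end WeightOne

section SymbolExactness

open IsSl2Module

variable {E : Type*} [NormedAddCommGroup E] [NormedSpace ℝ E] [Module ℍ[ℝ] E]
  [IsScalarTower ℝ ℍ[ℝ] E] {k : ℕ}

lemma exists_dual_vector {ξ : OneForm ℝ E} (hξ : ξ ≠ 0) :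
    ∃ v : E, ξ v = 1 ∧ ξ (qI • v) = 0 ∧ ξ (qJ • v) = 0 ∧ ξ (qK • v) = 0 := by
  obtain ⟨v, hv⟩ := DFunLike.ne_iff.mp hξ
  set N := ξ v ^ 2 + ξ (qI • v) ^ 2 + ξ (qJ • v) ^ 2 + ξ (qK • v) ^ 2 with hN
  have hN0 : N ≠ 0 := by
    have : ξ v ≠ 0 := hv
    positivity
  refine ⟨(ξ v / N) • v + (ξ (qI • v) / N) • qI • v + (ξ (qJ • v) / N) • qJ • v
    + (ξ (qK • v) / N) • qK • v, ?_, ?_, ?_, ?_⟩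
  · simp only [map_add, map_smul, smul_eq_mul]
    field_simp
    rw [hN]
  all_goals
    simp only [smul_add, smul_comm _ (_ : ℝ) (_ : E), smul_smul (_ : ℍ[ℝ]) (_ : ℍ[ℝ]),
      qI_mul_qI, qI_mul_qJ, qI_mul_qK, qJ_mul_qI, qJ_mul_qJ, qJ_mul_qK, qK_mul_qI, qK_mul_qJ,
      qK_mul_qK, neg_smul, one_smul, smul_neg, map_add, map_neg, map_smul, smul_eq_mul]
    ring

variable [ContinuousConstSMul ℍ[ℝ] E]

namespace HasWeightOne

variable {e : OneForm ℂ E}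

lemma pow_lowering_wedge_partner (he : HasWeightOne e) (i : ℕ) (α : Form ℂ E k) :
    (lowering ^ i) (wedge (partner e) α) = wedge (partner e) ((lowering ^ i) α) := by
  induction i with
  | zero => rfl
  | succ i ih => simp only [pow_succ', Module.End.mul_apply, ih, he.lowering_wedge_partner]

lemma pow_lowering_wedge (he : HasWeightOne e) (i : ℕ) (α : Form ℂ E k) :
    (lowering ^ (i + 1)) (wedge e α) =
      wedge e ((lowering ^ (i + 1)) α) + (i + 1 : ℂ) • wedge (partner e) ((lowering ^ i) α) := by
  induction i with
  | zero => simp [he.lowering_wedge, add_comm]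
  | succ i ih =>
    rw [pow_succ', Module.End.mul_apply, ih, map_add, map_smul, he.lowering_wedge,
      he.lowering_wedge_partner, ← Module.End.mul_apply, ← pow_succ', ← Module.End.mul_apply,
      ← pow_succ']
    push_cast
    module

variable [FiniteDimensional ℝ E]

lemma wedge_partner_pow_lowering_sub_mem (he : HasWeightOne e) {r : ℕ} {p : Form ℂ E k}
    (hp : p ∈ primitiveForms E k r) (i : ℕ) :
    wedge (partner e) ((lowering ^ i) p) - (r + 1 : ℂ)⁻¹ • (lowering ^ (i + 1)) (wedge e p)
      ∈ formsOfOtherTypes ℂ E (k + 1) (r + 1) := by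
  have hq := he.wedge_partner_sub_mem_primitiveForms (by omega) hp
  rw [Int.cast_natCast] at hq
  rw [← he.pow_lowering_wedge_partner, pow_succ, Module.End.mul_apply, ← map_smul, ← map_sub]
  rcases r with _ | r
  · rw [isSl2Module_form.eq_zero_of_mem_primitive (by simp) hq, map_zero]
    exact zero_mem _
  · refine formsOfType_le_formsOfOtherTypes (s := r) (by omega) ?_
    rw [← isotypic_eq_formsOfType]
    exact pow_Y_mem_isotypic (by simpa using hq) i

lemma wedge_pow_lowering_sub_mem (he : HasWeightOne e) {r : ℕ} {p : Form ℂ E k}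
    (hp : p ∈ primitiveForms E k r) (i : ℕ) :
    wedge e ((lowering ^ i) p) - ((r + 1 - i : ℂ) / (r + 1)) • (lowering ^ i) (wedge e p)
      ∈ formsOfOtherTypes ℂ E (k + 1) (r + 1) := by
  have hr : (r + 1 : ℂ) ≠ 0 := Nat.cast_add_one_ne_zero r
  rcases i with _ | i
  · simp [hr]
  · convert Submodule.smul_mem _ (-(i + 1 : ℂ)) (he.wedge_partner_pow_lowering_sub_mem hp i) using 1
    rw [eq_sub_of_add_eq (he.pow_lowering_wedge i p).symm]
    push_cast
    match_scalars <;> field_simp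
    ring

end HasWeightOne

variable {e₁ e₂ : OneForm ℂ E}

lemma assemble_wedgePencil {r : ℕ} {a : ℕ → Form ℂ E k} (ha : a (r + 1) = 0) :
    assemble lowering (r + 1) (wedgePencil e₁ e₂ a) = ∑ i ∈ Finset.range (r + 1),
      (((r + 1 - i).factorial : ℂ) • (lowering ^ i) (wedge e₁ (a i)) +
        ((r - i).factorial : ℂ) • (lowering ^ (i + 1)) (wedge e₂ (a i))) := by
  rw [assemble_apply, Finset.sum_range_succ', Finset.sum_add_distrib]
  simp only [wedgePencil, map_add, smul_add, Finset.sum_add_distrib, Nat.add_sub_add_right]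
  rw [add_right_comm]
  congr 1
  rw [Finset.sum_range_succ, Finset.sum_range_succ']
  simp [ha]

namespace IsWeightOnePair

lemma wedgePencil_natCast_mem (h : IsWeightOnePair e₁ e₂) {r : ℕ} {a : ℕ → Form ℂ E k}
    (ha : a ∈ primitivePolynomials raising cartan r r) :
    wedgePencil e₁ e₂ a ∈ primitivePolynomials raising cartan (r + 1 : ℕ) (r + 1) := by
  rw [Nat.cast_succ]
  exact h.wedgePencil_mem ha

variable [FiniteDimensional ℝ E]

lemma wedge_assemble_sub_mem (h : IsWeightOnePair e₁ e₂) {r : ℕ} {a : ℕ → Form ℂ E k}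
    (ha : a ∈ primitivePolynomials raising cartan r r) :
    wedge (e₁ + partner e₂) (assemble lowering r a) -
      (r + 1 : ℂ)⁻¹ • assemble lowering (r + 1) (wedgePencil e₁ e₂ a)
      ∈ formsOfOtherTypes ℂ E (k + 1) (r + 1) := by
  have hr : (r + 1 : ℂ) ≠ 0 := Nat.cast_add_one_ne_zero r
  rw [mem_primitivePolynomials] at ha
  rw [assemble_wedgePencil (ha.2 _ (Nat.lt_succ_self r)), assemble_apply, map_sum, Finset.smul_sum,
    ← Finset.sum_sub_distrib]
  refine sum_mem fun i hi => ?_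
  convert Submodule.smul_mem _ ((r - i).factorial : ℂ) (add_mem
    (h.left.wedge_pow_lowering_sub_mem (ha.1 i) i)
    (h.right.wedge_partner_pow_lowering_sub_mem (ha.1 i) i)) using 1
  have hir : i ≤ r := Nat.lt_succ_iff.mp (Finset.mem_range.mp hi)
  rw [Nat.succ_sub hir, Nat.factorial_succ, map_smul, map_add, LinearMap.add_apply]
  push_cast [Nat.cast_sub hir]
  match_scalars <;> field_simp
  ring

lemma assemble_wedgePencil_eq_zero (h : IsWeightOnePair e₁ e₂) {r : ℕ} {a : ℕ → Form ℂ E k}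
    (ha : a ∈ primitivePolynomials raising cartan r r)
    (hβ : wedge (e₁ + partner e₂) (assemble lowering r a) ∈ formsOfOtherTypes ℂ E (k + 1) (r + 1)) :
    assemble lowering (r + 1) (wedgePencil e₁ e₂ a) = 0 := by
  have hr : (r + 1 : ℂ) ≠ 0 := Nat.cast_add_one_ne_zero r
  have assemble_mem := assemble_mem_isotypic (Y := lowering) (h.wedgePencil_natCast_mem ha)
  rw [isotypic_eq_formsOfType] at assemble_mem
  refine Submodule.disjoint_def.mp (disjoint_formsOfType (r + 1)) _ assemble_mem ?_
  rw [← Submodule.smul_mem_iff _ (inv_ne_zero hr)]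
  simpa using sub_mem hβ (h.wedge_assemble_sub_mem ha)

lemma wedge_mem_formsOfOtherTypes_iff (h : IsWeightOnePair e₁ e₂) {r : ℕ} (hkr : k = 0 ∨ 0 < r)
    {β : Form ℂ E (k + 1)} (hβ : β ∈ formsOfType ℂ E (k + 1) (r + 1)) :
    wedge (e₁ + partner e₂) β ∈ formsOfOtherTypes ℂ E (k + 2) (r + 2) ↔
      ∃ γ ∈ formsOfType ℂ E k r,
        wedge (e₁ + partner e₂) γ - β ∈ formsOfOtherTypes ℂ E (k + 1) (r + 1) := by
  have hr : (r + 1 : ℂ) ≠ 0 := Nat.cast_add_one_ne_zero r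
  simp only [← isotypic_eq_formsOfType]
  rw [← isotypic_eq_formsOfType] at hβ
  constructor
  · intro hβ₂
    obtain ⟨a, ha, rfl⟩ := isSl2Module_form.exists_assemble_eq hβ
    have pencil_eq_zero := isSl2Module_form.eq_zero_of_assemble_eq_zero
      (h.wedgePencil_natCast_mem ha) (h.assemble_wedgePencil_eq_zero ha hβ₂)
    rw [Nat.cast_succ] at ha
    obtain ⟨b, hb, rfl⟩ := h.exists_wedgePencil_eq (Nat.cast_nonneg r) (by simpa using hkr) ha
      (congrFun pencil_eq_zero)
    refine ⟨(r + 1 : ℂ) • assemble lowering r b,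
      Submodule.smul_mem _ _ (assemble_mem_isotypic hb), ?_⟩
    convert Submodule.smul_mem _ (r + 1 : ℂ) (h.wedge_assemble_sub_mem hb) using 1
    rw [map_smul, smul_sub, smul_inv_smul₀ hr]
  · rintro ⟨γ, hγ, hγβ⟩
    obtain ⟨b, hb, rfl⟩ := isSl2Module_form.exists_assemble_eq hγ
    have hpencil := h.wedgePencil_natCast_mem hb
    have hβ_eq : (r + 1 : ℂ)⁻¹ • assemble lowering (r + 1) (wedgePencil e₁ e₂ b) = β := by
      refine eq_of_sub_mem_formsOfOtherTypes (r := r + 1) ?_ ?_ ?_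
      · rw [← isotypic_eq_formsOfType]
        exact Submodule.smul_mem _ _ (assemble_mem_isotypic hpencil)
      · rwa [← isotypic_eq_formsOfType]
      · simpa using sub_mem hγβ (h.wedge_assemble_sub_mem hb)
    rw [← hβ_eq, map_smul]
    refine Submodule.smul_mem _ _ ?_
    simpa [wedgePencil_wedgePencil] using h.wedge_assemble_sub_mem hpencil

end IsWeightOnePair

/-- The component of weight `1` of a complex one-form. -/
def weightOnePart (ξ : OneForm ℂ E) : OneForm ℂ E :=
  (1 / 2 : ℂ) • (ξ + Complex.I • ξ ∘L (qI • ContinuousLinearMap.id ℝ E))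

lemma weightOnePart_apply (ξ : OneForm ℂ E) (v : E) :
    weightOnePart ξ v = (1 / 2 : ℂ) * (ξ v + Complex.I * ξ (qI • v)) := rfl

lemma hasWeightOne_weightOnePart (ξ : OneForm ℂ E) : HasWeightOne (weightOnePart ξ) := by
  intro v
  rw [weightOnePart_apply, weightOnePart_apply, smul_smul, qI_mul_qI, neg_one_smul, map_neg]
  linear_combination (-1 / 2 : ℂ) * ξ v * Complex.I_mul_I

lemma weightOnePart_add_partner (ξ : OneForm ℂ E) :
    weightOnePart ξ + partner (weightOnePart (-partner ξ)) = ξ := by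
  ext v
  rw [_root_.add_apply, partner_apply, weightOnePart_apply, weightOnePart_apply, _root_.neg_apply,
    _root_.neg_apply, partner_apply, partner_apply]
  simp only [smul_smul, ← mul_assoc]
  simp only [mul_assoc, qI_mul_qJ, qJ_mul_qJ, qJ_mul_qK, neg_smul, one_smul, map_neg]
  ring

lemma isWeightOnePair_weightOnePart {ξ : OneForm ℝ E} (hξ : ξ ≠ 0) :
    IsWeightOnePair (weightOnePart (Complex.ofRealCLM ∘L ξ))
      (weightOnePart (-partner (Complex.ofRealCLM ∘L ξ))) := by
  obtain ⟨v, hv, hI, hJ, hK⟩ := exists_dual_vector hξ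
  refine ⟨hasWeightOne_weightOnePart _, hasWeightOne_weightOnePart _,
    ⟨(2 : ℝ) • v, ?_, ?_⟩, ⟨(2 : ℝ) • qJ • v, ?_⟩⟩
  · simp [weightOnePart_apply, hv, hI]
  · simp [weightOnePart_apply, partner_apply, smul_smul _ _ v, qJ_mul_qI, hJ,
      hK]
  · simp [weightOnePart_apply, partner_apply, smul_smul _ _ v, qI_mul_qJ,
      qJ_mul_qJ, qJ_mul_qK, hv, hI]

variable [FiniteDimensional ℝ E]

lemma wedge_mem_formsOfOtherTypes_iff {ξ : OneForm ℝ E} (hξ : ξ ≠ 0) {r : ℕ}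
    (hkr : k = 0 ∨ 0 < r) {β : Form ℝ E (k + 1)} (hβ : β ∈ formsOfType ℝ E (k + 1) (r + 1)) :
    wedge ξ β ∈ formsOfOtherTypes ℝ E (k + 2) (r + 2) ↔
      ∃ γ ∈ formsOfType ℝ E k r, wedge ξ γ - β ∈ formsOfOtherTypes ℝ E (k + 1) (r + 1) := by
  have complexify_wedge {l : ℕ} (α : Form ℝ E l) :
      complexify (wedge ξ α) = wedge (Complex.ofRealCLM ∘L ξ) (complexify α) :=
    compContinuousAlternatingMap_wedge (fun v z => by simp) α
  have complex_iff := (isWeightOnePair_weightOnePart hξ).wedge_mem_formsOfOtherTypes_iff hkr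
    (complexify_mem_formsOfType.mpr hβ)
  rw [weightOnePart_add_partner] at complex_iff
  rw [← complexify_mem_formsOfOtherTypes, complexify_wedge, complex_iff]
  constructor
  · rintro ⟨γ, hγ, h⟩
    refine ⟨_, compContinuousAlternatingMap_mem_formsOfType Complex.reCLM hγ, ?_⟩
    convert compContinuousAlternatingMap_mem_formsOfOtherTypes Complex.reCLM h using 1
    rw [← compContinuousAlternatingMap_wedge (ξ := Complex.ofRealCLM ∘L ξ) (fun v z => by simp)]
    rfl
  · rintro ⟨γ, hγ, h⟩
    refine ⟨_, complexify_mem_formsOfType.mpr hγ, ?_⟩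
    rw [← complexify_wedge]
    convert complexify_mem_formsOfOtherTypes.mpr h using 1
    ext v
    simp

end SymbolExactness

section InvariantForms

variable {E : Type*} [NormedAddCommGroup E] [NormedSpace ℝ E] {k : ℕ}

lemma wedge_contr_of_wedge_eq_zero {η : OneForm ℝ E} {β : Form ℝ E (k + 1)} (h : wedge η β = 0)
    (u : E) : wedge η (contr u β) = η u • β := by
  have h' := contr_wedge u η β
  rw [h, map_zero] at h'
  exact (sub_eq_zero.mp h'.symm).symm

/-- The form `α` is horizontal with respect to the vector `u`: in positive degree this says that the
contraction with `u` kills `α`, in degree zero it is void. -/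
def IsHorizontal (u : E) (α : Form ℝ E k) : Prop :=
  ∀ η : OneForm ℝ E, contr u (wedge η α) = η u • α

lemma isHorizontal_zero_form (u : E) (α : Form ℝ E 0) : IsHorizontal u α :=
  fun η => contr_wedge_zero u η α

namespace IsHorizontal

variable {u : E} {α β : Form ℝ E k}

lemma wedge (h : IsHorizontal u α) {η : OneForm ℝ E} (hη : η u = 0) :
    IsHorizontal u (wedge η α) := fun η' => by
  rw [contr_wedge, h η, hη, zero_smul, map_zero, sub_zero]

lemma add (hα : IsHorizontal u α) (hβ : IsHorizontal u β) : IsHorizontal u (α + β) := fun η => by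
  rw [map_add, map_add, hα η, hβ η, smul_add]

lemma eq_zero (h : IsHorizontal u α) {η : OneForm ℝ E} (hη : η u ≠ 0)
    (h0 : QuaternionicForms.wedge η α = 0) : α = 0 := by
  have h' := h η
  rw [h0, map_zero, eq_comm, smul_eq_zero] at h'
  exact h'.resolve_left hη

end IsHorizontal

variable [Module ℍ[ℝ] E] [ContinuousConstSMul ℍ[ℝ] E] [IsScalarTower ℝ ℍ[ℝ] E]

/-- The covector `v ↦ ξ (q v)`. -/
def rotate (q : ℍ[ℝ]) (ξ : OneForm ℝ E) : OneForm ℝ E := ξ ∘L (q • ContinuousLinearMap.id ℝ E)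

lemma rotate_apply (q : ℍ[ℝ]) (ξ : OneForm ℝ E) (v : E) : rotate q ξ v = ξ (q • v) := rfl

lemma rotate_rotate (p q : ℍ[ℝ]) (ξ : OneForm ℝ E) : rotate p (rotate q ξ) = rotate (q * p) ξ := by
  ext v; simp only [rotate_apply, mul_smul]

lemma rotate_neg (q : ℍ[ℝ]) (ξ : OneForm ℝ E) : rotate (-q) ξ = -rotate q ξ := by
  ext v; simp only [rotate_apply, neg_smul, map_neg, _root_.neg_apply]

lemma rotate_one (ξ : OneForm ℝ E) : rotate 1 ξ = ξ := by
  ext v; rw [rotate_apply, one_smul]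

lemma quaternionAct_wedge_rotate (q : ℍ[ℝ]) (ξ : OneForm ℝ E) (α : Form ℝ E k) :
    quaternionAct q (wedge ξ α) = -wedge (rotate q ξ) α + wedge ξ (quaternionAct q α) := by
  rw [quaternionAct_wedge, map_neg, LinearMap.neg_apply, rotate]

/-- The product with the invariant two-form `ξ ∧ Iξ + Jξ ∧ Kξ`, where `qξ = rotate q ξ`. -/
def wedgeInvariant (ξ : OneForm ℝ E) : Form ℝ E k →ₗ[ℝ] Form ℝ E (k + 2) :=
  wedge ξ ∘ₗ wedge (rotate qI ξ) + wedge (rotate qJ ξ) ∘ₗ wedge (rotate qK ξ)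

lemma wedgeInvariant_apply (ξ : OneForm ℝ E) (α : Form ℝ E k) :
    wedgeInvariant ξ α =
      wedge ξ (wedge (rotate qI ξ) α) + wedge (rotate qJ ξ) (wedge (rotate qK ξ) α) := rfl

/-- The product with the four-form `ξ ∧ Iξ ∧ Jξ ∧ Kξ`, where `qξ = rotate q ξ`. -/
def wedgeVolume (ξ : OneForm ℝ E) (α : Form ℝ E k) : Form ℝ E (k + 4) :=
  wedge ξ (wedge (rotate qI ξ) (wedge (rotate qJ ξ) (wedge (rotate qK ξ) α)))

lemma wedge_wedgeVolume (ξ : OneForm ℝ E) (α : Form ℝ E k) : wedge ξ (wedgeVolume ξ α) = 0 :=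
  wedge_self _ _

lemma wedge_wedge_rotate_wedgeInvariant (ξ : OneForm ℝ E) (α : Form ℝ E k) :
    wedge ξ (wedge (rotate qI ξ) (wedgeInvariant ξ α)) = wedgeVolume ξ α := by
  rw [wedgeInvariant_apply, map_add, map_add, wedge_wedge_comm (rotate qI ξ) ξ, wedge_self,
    map_zero, neg_zero, map_zero, zero_add, wedgeVolume]

lemma wedgeInvariant_wedgeInvariant (ξ : OneForm ℝ E) (α : Form ℝ E k) :
    wedgeInvariant ξ (wedgeInvariant ξ α) = (2 : ℝ) • wedgeVolume ξ α := by
  rw [wedgeInvariant_apply, wedge_wedge_rotate_wedgeInvariant, wedgeInvariant_apply]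
  have h : wedge (rotate qJ ξ) (wedge (rotate qK ξ) (wedge ξ (wedge (rotate qI ξ) α))) =
      wedgeVolume ξ α := by
    rw [wedgeVolume, wedge_wedge_comm (rotate qK ξ) ξ, wedge_wedge_comm (rotate qK ξ) (rotate qI ξ)]
    simp only [map_neg, neg_neg]
    rw [wedge_wedge_comm (rotate qJ ξ) ξ, wedge_wedge_comm (rotate qJ ξ) (rotate qI ξ), map_neg,
      neg_neg]
  rw [map_add, map_add, h, wedge_wedge_comm (rotate qK ξ) (rotate qJ ξ), map_neg, wedge_self,
    neg_zero, add_zero, two_smul]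

lemma IsHorizontal.wedgeInvariant {u : E} {ξ : OneForm ℝ E} {α : Form ℝ E k}
    (h : IsHorizontal u α) (hξ : ∀ q : ℍ[ℝ], ξ (q • u) = 0) :
    IsHorizontal u (wedgeInvariant ξ α) :=
  ((h.wedge (hξ qI)).wedge (by simpa using hξ 1)).add ((h.wedge (hξ qK)).wedge (hξ qJ))

lemma eq_zero_of_wedgeVolume_eq_zero {ξ : OneForm ℝ E} {v : E} {α : Form ℝ E k}
    (hξ : ∀ q : ℍ[ℝ], ξ (q • v) = q.re) (hα : ∀ q : ℍ[ℝ], IsHorizontal (q • v) α)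
    (h0 : wedgeVolume ξ α = 0) : α = 0 := by
  have rotate_smul (p q : ℍ[ℝ]) : rotate p ξ (q • v) = (p * q).re := by
    rw [rotate_apply, smul_smul, hξ]
  have rotate_self (p : ℍ[ℝ]) : rotate p ξ v = p.re := hξ p
  have hv : IsHorizontal v α := by simpa using hα 1
  have hI := (((hv.wedge (rotate_self qK)).wedge (rotate_self qJ)).wedge (rotate_self qI)).eq_zero
    (by simpa using (hξ 1).trans_ne one_ne_zero) h0
  have hJ := (((hα qI).wedge (η := rotate qK ξ) (by simp [rotate_smul])).wedge
    (η := rotate qJ ξ) (by simp [rotate_smul])).eq_zero (by simp [rotate_smul]) hI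
  have hK := ((hα qJ).wedge (η := rotate qK ξ) (by simp [rotate_smul])).eq_zero
    (by simp [rotate_smul]) hJ
  exact (hα qK).eq_zero (by simp [rotate_smul]) hK

lemma ne_zero_of_wedgeVolume_ne_zero {ξ : OneForm ℝ E} {α : Form ℝ E k}
    (h : wedgeVolume ξ α ≠ 0) : ξ ≠ 0 := by
  rintro rfl
  exact h (by rw [wedgeVolume, map_zero, LinearMap.zero_apply])

variable [FiniteDimensional ℝ E] {α : Form ℝ E k}

lemma wedge_mem_formsOfType_one (ξ : OneForm ℝ E) (hα : α ∈ formsOfType ℝ E k 0) :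
    wedge ξ α ∈ formsOfType ℝ E (k + 1) 1 := by
  have act (q : ℍ[ℝ]) (hq : q.re = 0) (η : OneForm ℝ E) :
      quaternionAct q (wedge η α) = -wedge (rotate q η) α := by
    rw [quaternionAct_wedge_rotate, quaternionAct_eq_zero hα hq, map_zero, add_zero]
  rw [mem_formsOfType, quaternionCasimir_apply]
  simp only [act qI rfl, act qJ rfl, act qK rfl, map_neg, rotate_rotate, qI_mul_qI, qJ_mul_qJ,
    qK_mul_qK, rotate_neg, rotate_one, LinearMap.neg_apply]
  norm_num
  module

lemma wedge_mem_formsOfOtherTypes_one_iff {ξ : OneForm ℝ E} (hα : α ∈ formsOfType ℝ E k 0) :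
    wedge ξ α ∈ formsOfOtherTypes ℝ E (k + 1) 1 ↔ wedge ξ α = 0 :=
  ⟨Submodule.disjoint_def.mp (disjoint_formsOfType 1) _ (wedge_mem_formsOfType_one ξ hα),
    fun h => h ▸ zero_mem _⟩

lemma wedge_rotate_eq_zero {ξ : OneForm ℝ E} (hα : α ∈ formsOfType ℝ E k 0) (h : wedge ξ α = 0)
    {q : ℍ[ℝ]} (hq : q.re = 0) : wedge (rotate q ξ) α = 0 := by
  have h' := quaternionAct_wedge_rotate q ξ α
  rw [h, quaternionAct_eq_zero hα hq, map_zero, map_zero, add_zero] at h'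
  exact neg_eq_zero.mp h'.symm

lemma eq_zero_of_wedge_eq_zero_of_invariant {ξ : OneForm ℝ E} (hξ : ξ ≠ 0) {β : Form ℝ E 2}
    (hβ : β ∈ formsOfType ℝ E 2 0) (h : wedge ξ β = 0) : β = 0 := by
  obtain ⟨v, hv, hI, hJ, hK⟩ := exists_dual_vector hξ
  set c := contr (qI • v) (contr v β)
  have contr_I : contr (qI • v) β = -wedge ξ c := by
    have h' := congrArg (contr (qI • v)) (wedge_contr_of_wedge_eq_zero h v)
    rw [hv, one_smul, contr_wedge, hI, zero_smul, zero_sub] at h'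
    exact h'.symm
  have β_eq : β = wedge (rotate qI ξ) (wedge ξ c) := by
    have h' := wedge_contr_of_wedge_eq_zero (wedge_rotate_eq_zero hβ h qI_re) (qI • v)
    rw [contr_I, rotate_apply, smul_smul, qI_mul_qI, neg_one_smul, map_neg, map_neg, hv] at h'
    simpa using h'.symm
  have contr_J : contr (qJ • v) β = 0 := by
    rw [β_eq, contr_wedge, contr_wedge_zero, rotate_apply, smul_smul, qI_mul_qJ, hK, hJ]
    simp
  have h' := wedge_contr_of_wedge_eq_zero (wedge_rotate_eq_zero hβ h qJ_re) (qJ • v)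
  rw [contr_J, map_zero, rotate_apply, smul_smul, qJ_mul_qJ, neg_one_smul, map_neg, hv] at h'
  simpa using h'.symm

lemma wedgeInvariant_mem_formsOfType_zero (ξ : OneForm ℝ E) (hα : α ∈ formsOfType ℝ E k 0) :
    wedgeInvariant ξ α ∈ formsOfType ℝ E (k + 2) 0 := by
  have act (q : ℍ[ℝ]) (hq : q.re = 0) (η ζ : OneForm ℝ E) : quaternionAct q (wedge η (wedge ζ α)) =
      -wedge (rotate q η) (wedge ζ α) - wedge η (wedge (rotate q ζ) α) := by
    rw [quaternionAct_wedge_rotate, quaternionAct_wedge_rotate, quaternionAct_eq_zero hα hq,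
      map_zero, add_zero, map_neg, sub_eq_add_neg]
  refine mem_formsOfType_zero fun q hq => ?_
  rw [quaternionAct_of_re_eq_zero hq, wedgeInvariant_apply]
  simp only [map_add, act qI rfl, act qJ rfl, act qK rfl, rotate_rotate, qI_mul_qI, qI_mul_qJ,
    qI_mul_qK, qJ_mul_qI, qJ_mul_qJ, qJ_mul_qK, qK_mul_qI, qK_mul_qJ, qK_mul_qK, rotate_neg,
    rotate_one, map_neg, LinearMap.neg_apply, wedge_self,
    wedge_wedge_comm (rotate qK ξ) (rotate qI ξ), wedge_wedge_comm (rotate qJ ξ) ξ]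
  module

section DualFamilies

variable {n : ℕ} {a : Fin n → OneForm ℝ E} {e : Fin n → E}
  (hae : ∀ i j (q : ℍ[ℝ]), a i (q • e j) = if i = j then q.re else 0)

include hae

lemma exists_invariant_ne_zero (l N : ℕ) (hl : l ≤ n) (hN : N ≤ 2 * l) :
    ∃ ρ ∈ formsOfType ℝ E (2 * N) 0, ρ ≠ 0 ∧
      ∀ i : Fin n, l ≤ i → ∀ q : ℍ[ℝ], IsHorizontal (q • e i) ρ := by
  induction l generalizing N with
  | zero =>
    obtain rfl : N = 0 := by omega
    refine ⟨ContinuousAlternatingMap.constOfIsEmpty ℝ E (Fin 0) (1 : ℝ),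
      mem_formsOfType_zero fun q _ => der_zero_form _ _, ?_,
      fun i _ q => isHorizontal_zero_form _ _⟩
    exact fun h => one_ne_zero (congrArg (fun α : Form ℝ E 0 => α ![]) h)
  | succ l ih =>
    rcases le_or_gt N (2 * l) with hN' | hN'
    · obtain ⟨ρ, hρ, hρ0, horizontal⟩ := ih N (by omega) hN'
      exact ⟨ρ, hρ, hρ0, fun i hi => horizontal i (by omega)⟩
    obtain ⟨ρ, hρ, hρ0, horizontal⟩ := ih (2 * l) (by omega) le_rfl
    set ξ := a ⟨l, hl⟩
    have horizontal_wedgeInvariant {j : ℕ} {β : Form ℝ E j}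
        (hβ : ∀ i : Fin n, l + 1 ≤ i → ∀ q : ℍ[ℝ], IsHorizontal (q • e i) β) (i : Fin n)
        (hi : l + 1 ≤ i) (q : ℍ[ℝ]) : IsHorizontal (q • e i) (wedgeInvariant ξ β) := by
      refine (hβ i hi q).wedgeInvariant fun p => ?_
      rw [smul_smul, hae, if_neg (by rintro rfl; simp at hi)]
    have volume_ne_zero : wedgeVolume ξ ρ ≠ 0 := fun h => hρ0 <|
      eq_zero_of_wedgeVolume_eq_zero (fun q => by rw [hae, if_pos rfl]) (horizontal _ le_rfl) h
    have square_ne_zero : wedgeInvariant ξ (wedgeInvariant ξ ρ) ≠ 0 := by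
      rw [wedgeInvariant_wedgeInvariant]
      exact smul_ne_zero two_ne_zero volume_ne_zero
    have mem := wedgeInvariant_mem_formsOfType_zero ξ hρ
    have horizontal' := horizontal_wedgeInvariant fun i hi => horizontal i (by omega)
    obtain rfl | rfl : N = 2 * l + 1 ∨ N = 2 * l + 2 := by omega
    · exact ⟨_, mem, fun h => square_ne_zero (by rw [h, map_zero]), horizontal'⟩
    · exact ⟨_, wedgeInvariant_mem_formsOfType_zero ξ mem, square_ne_zero,
        horizontal_wedgeInvariant horizontal'⟩

lemma exists_wedgeVolume_ne_zero {N : ℕ} (hN : N + 2 ≤ 2 * n) :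
    ∃ ξ : OneForm ℝ E, ∃ ρ ∈ formsOfType ℝ E (2 * N) 0, wedgeVolume ξ ρ ≠ 0 := by
  obtain ⟨ρ, hρ, hρ0, horizontal⟩ := exists_invariant_ne_zero hae (n - 1) N (by omega) (by omega)
  refine ⟨a ⟨n - 1, by omega⟩, ρ, hρ, fun h => hρ0 ?_⟩
  exact eq_zero_of_wedgeVolume_eq_zero (fun q => by rw [hae, if_pos rfl]) (horizontal _ le_rfl) h

end DualFamilies

lemma exists_ne_zero_wedge_eq_zero {ξ : OneForm ℝ E} (hα : α ∈ formsOfType ℝ E k 0)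
    (h : wedgeVolume ξ α ≠ 0) :
    ∃ β ∈ formsOfType ℝ E (k + 4) 0, β ≠ 0 ∧ wedge ξ β = 0 := by
  refine ⟨wedgeInvariant ξ (wedgeInvariant ξ α),
    wedgeInvariant_mem_formsOfType_zero ξ (wedgeInvariant_mem_formsOfType_zero ξ hα), ?_, ?_⟩
  · rw [wedgeInvariant_wedgeInvariant]
    exact smul_ne_zero two_ne_zero h
  · rw [wedgeInvariant_wedgeInvariant, map_smul, wedge_wedgeVolume, smul_zero]

lemma exists_wedge_mem_formsOfOtherTypes_two {ξ : OneForm ℝ E} (hα : α ∈ formsOfType ℝ E k 0)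
    (h : wedgeVolume ξ α ≠ 0) :
    ∃ β ∈ formsOfType ℝ E (k + 3) 1, wedge ξ β ∈ formsOfOtherTypes ℝ E (k + 4) 2 ∧
      ¬ ∃ γ ∈ formsOfType ℝ E (k + 2) 0, wedge ξ γ - β ∈ formsOfOtherTypes ℝ E (k + 3) 1 := by
  have mem := wedgeInvariant_mem_formsOfType_zero ξ hα
  have mem_one := wedge_mem_formsOfType_one (rotate qI ξ) mem
  refine ⟨_, mem_one, ?_, ?_⟩
  · refine formsOfType_le_formsOfOtherTypes (s := 0) (by omega) ?_
    rw [wedge_wedge_rotate_wedgeInvariant, ← Submodule.smul_mem_iff _ (two_ne_zero (α := ℝ)),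
      ← wedgeInvariant_wedgeInvariant]
    exact wedgeInvariant_mem_formsOfType_zero ξ mem
  · rintro ⟨γ, hγ, hγβ⟩
    have hβ := eq_of_sub_mem_formsOfOtherTypes (wedge_mem_formsOfType_one ξ hγ) mem_one hγβ
    rw [← wedge_wedge_rotate_wedgeInvariant, ← hβ, wedge_self] at h
    exact h rfl

end InvariantForms

section Model

variable {𝕜 : Type*} [RCLike 𝕜] {E E' : Type*} [NormedAddCommGroup E] [NormedSpace ℝ E]
  [Module ℍ[ℝ] E] [IsScalarTower ℝ ℍ[ℝ] E] [ContinuousConstSMul ℍ[ℝ] E] [NormedAddCommGroup E']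
  [NormedSpace ℝ E'] [Module ℍ[ℝ] E'] [IsScalarTower ℝ ℍ[ℝ] E'] [ContinuousConstSMul ℍ[ℝ] E']
  {n k r : ℕ}

lemma quaternionCasimir_conj {q : ℍ[ℝ]} (hq : ‖q‖ = 1) (α : Form 𝕜 E k) :
    quaternionAct (q * qI * star q) (quaternionAct (q * qI * star q) α)
      + quaternionAct (q * qJ * star q) (quaternionAct (q * qJ * star q) α)
      + quaternionAct (q * qK * star q) (quaternionAct (q * qK * star q) α)
      = quaternionCasimir α := by
  -- The coefficients form the matrix of the rotation `u ↦ q u q⁻¹` of the imaginary quaternions;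
  -- the identity expresses its orthogonality.
  have hI : q * qI * star q = (q.re ^ 2 + q.imI ^ 2 - q.imJ ^ 2 - q.imK ^ 2) • qI
      + (2 * (q.imI * q.imJ + q.re * q.imK)) • qJ
      + (2 * (q.imI * q.imK - q.re * q.imJ)) • qK := by
    ext <;> simp <;> ring
  have hJ : q * qJ * star q = (2 * (q.imI * q.imJ - q.re * q.imK)) • qI
      + (q.re ^ 2 - q.imI ^ 2 + q.imJ ^ 2 - q.imK ^ 2) • qJ
      + (2 * (q.imJ * q.imK + q.re * q.imI)) • qK := by
    ext <;> simp <;> ring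
  have hK : q * qK * star q = (2 * (q.imI * q.imK + q.re * q.imJ)) • qI
      + (2 * (q.imJ * q.imK - q.re * q.imI)) • qJ
      + (q.re ^ 2 - q.imI ^ 2 - q.imJ ^ 2 + q.imK ^ 2) • qK := by
    ext <;> simp <;> ring
  have hnorm : q.re ^ 2 + q.imI ^ 2 + q.imJ ^ 2 + q.imK ^ 2 = 1 := by
    rw [← Quaternion.normSq_def', Quaternion.normSq_eq_norm_mul_self, hq, mul_one]
  simp only [hI, hJ, hK, quaternionCasimir_apply, map_add, map_smul, LinearMap.add_apply,
    LinearMap.smul_apply, LinearMap.map_smul_of_tower]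
  match_scalars
  all_goals first
    | linear_combination (q.re ^ 2 + q.imI ^ 2 + q.imJ ^ 2 + q.imK ^ 2 + 1) * hnorm
    | ring

lemma compContinuousLinearMap_mem_formsOfType {q : ℍ[ℝ]} (hq : ‖q‖ = 1) {L : E' →L[ℝ] E}
    (hL : ∀ (u : ℍ[ℝ]) v, L (u • v) = (q * u * star q) • L v) {α : Form 𝕜 E k}
    (hα : α ∈ formsOfType 𝕜 E k r) :
    α.compContinuousLinearMap L ∈ formsOfType 𝕜 E' k r := by
  have hact (u : ℍ[ℝ]) (β : Form 𝕜 E k) : quaternionAct u (β.compContinuousLinearMap L)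
      = (quaternionAct (q * u * star q) β).compContinuousLinearMap L :=
    der_compContinuousLinearMap (ContinuousLinearMap.ext (hL u)) β
  rw [mem_formsOfType, ← quaternionCasimir_conj hq] at hα
  rw [mem_formsOfType, quaternionCasimir_apply]
  simp only [hact]
  exact congrArg (·.compContinuousLinearMap L) hα

lemma MemSp1GL.compContinuousLinearMap_mem_formsOfType {g : HSpace n ≃L[ℝ] HSpace n}
    (hg : MemSp1GL g) {α : Form 𝕜 (HSpace n) k} (hα : α ∈ formsOfType 𝕜 (HSpace n) k r) :
    α.compContinuousLinearMap (g : HSpace n →L[ℝ] HSpace n) ∈ formsOfType 𝕜 (HSpace n) k r := by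
  obtain ⟨q, hq, A, hA⟩ := hg
  have hqq : star q * q = 1 := by
    rw [Quaternion.star_mul_self, Quaternion.normSq_eq_norm_mul_self, hq, mul_one,
      Quaternion.coe_one]
  refine QuaternionicForms.compContinuousLinearMap_mem_formsOfType hq (fun u v => ?_) hα
  change g (u • v) = (q * u * star q) • g v
  rw [hA, hA, map_smul, smul_smul, smul_smul, mul_assoc (q * u), hqq, mul_one]

lemma isHighestWeight_iff_mem_primitive {α : Form ℂ (HSpace n) k} :
    IsHighestWeight r α ↔ α ∈ IsSl2Module.primitive raising cartan r := by
  rw [IsSl2Module.mem_primitive, raising_apply, smul_eq_zero_iff_right (by norm_num), cartan_apply]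
  refine and_congr_left' ⟨fun h => ?_, fun h => ?_⟩
  · rw [show quaternionAct qI α = (Complex.I * r) • α from h, smul_smul, ← mul_assoc]
    simp
  · change quaternionAct qI α = _
    rw [mul_smul, ← Int.cast_natCast, ← h, smul_smul]
    simp

lemma modelEC_eq_formsOfType : modelEC n k r = formsOfType ℂ (HSpace n) k r := by
  refine le_antisymm (sInf_le ⟨fun q hq α hα => quaternionAct_mem_formsOfType hα hq,
    fun α hα => ?_⟩) (le_sInf fun W ⟨hW_act, hW⟩ => ?_)
  · rw [← isotypic_eq_formsOfType]
    exact IsSl2Module.primitive_le_isotypic r (isHighestWeight_iff_mem_primitive.mp hα)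
  · rw [← isotypic_eq_formsOfType]
    refine iSup_le fun i => Submodule.map_le_iff_le_comap.mpr fun α hα => ?_
    induction i with
    | zero => exact hW α (isHighestWeight_iff_mem_primitive.mpr hα)
    | succ i ih =>
      rw [Submodule.mem_comap, pow_succ', Module.End.mul_apply]
      exact W.smul_mem _ (W.add_mem (hW_act qJ rfl _ ih) (W.smul_mem _ (hW_act qK rfl _ ih)))

lemma modelE_eq_formsOfType : modelE n k r = formsOfType ℝ (HSpace n) k r := by
  ext α
  rw [← complexify_mem_formsOfType, ← modelEC_eq_formsOfType]
  rfl

end Model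

section Fibres

variable {n k r : ℕ} {M : Type*} [TopologicalSpace M]
  [ChartedSpace (EuclideanSpace ℝ (Fin (4 * n))) M] {x : M}

/-- The linear frames at `x`, as isomorphisms onto the model space `ℍⁿ`. -/
abbrev LinearFrame (n : ℕ) {M : Type*} [TopologicalSpace M]
    [ChartedSpace (EuclideanSpace ℝ (Fin (4 * n))) M] (x : M) : Type :=
  TangentSpace (𝓡 (4 * n)) x ≃L[ℝ] HSpace n

/-- The expression of the `k`-covectors at `x` in a frame. -/
def formEquiv (p : LinearFrame n x) : Covectors n k x ≃L[ℝ] Form ℝ (HSpace n) k :=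
  p.continuousAlternatingMapCongrLeft

/-- The expression of the covectors at `x` in a frame. -/
def oneFormEquiv (p : LinearFrame n x) :
    (TangentSpace (𝓡 (4 * n)) x →L[ℝ] ℝ) ≃L[ℝ] OneForm ℝ (HSpace n) :=
  p.arrowCongr (.refl ℝ ℝ)

lemma formEquiv_compContinuousLinearMap (p p' : LinearFrame n x) (α : Covectors n k x) :
    (formEquiv p α).compContinuousLinearMap (p'.symm.trans p : HSpace n →L[ℝ] HSpace n)
      = formEquiv p' α := by
  ext v
  exact congrArg α (funext fun i => p.symm_apply_apply (p'.symm (v i)))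

namespace Sp1GLStructure

variable [IsManifold (𝓡 (4 * n)) ∞ M] (Q : Sp1GLStructure n M) {p : LinearFrame n x}

lemma frames_nonempty (x : M) : (Q.frames x).Nonempty := by
  obtain ⟨U, hU, p, hp, -⟩ := Q.exists_section x
  exact ⟨p x, hp x (mem_of_mem_nhds hU)⟩

lemma mem_E_iff (hp : p ∈ Q.frames x) {α : Covectors n k x} :
    α ∈ Q.E k r x ↔ formEquiv p α ∈ formsOfType ℝ (HSpace n) k r := by
  simp only [E, Submodule.mem_iInf, Submodule.mem_comap, modelE_eq_formsOfType]
  refine ⟨fun h => h p hp, fun h p' hp' => ?_⟩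
  have h' := ((Q.mem_iff x p' hp' p).mp hp).compContinuousLinearMap_mem_formsOfType h
  rwa [formEquiv_compContinuousLinearMap] at h'

lemma E_eq_comap (hp : p ∈ Q.frames x) : Q.E k r x =
    (Submodule.orderIsoMapComap (formEquiv p).toLinearEquiv).symm
      (formsOfType ℝ (HSpace n) k r) := by
  ext α
  exact Q.mem_E_iff hp

lemma iSup_E_eq_comap (hp : p ∈ Q.frames x) : ⨆ s : ℕ, ⨆ _ : s ≠ r, Q.E k s x =
    (Submodule.orderIsoMapComap (formEquiv p).toLinearEquiv).symm
      (formsOfOtherTypes ℝ (HSpace n) k r) := by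
  simp only [formsOfOtherTypes, OrderIso.map_iSup, Q.E_eq_comap hp]

lemma isCompl_E (x : M) : IsCompl (Q.E k r x) (⨆ s : ℕ, ⨆ _ : s ≠ r, Q.E k s x) := by
  obtain ⟨p, hp⟩ := Q.frames_nonempty x
  rw [Q.E_eq_comap hp, Q.iSup_E_eq_comap hp]
  exact OrderIso.isCompl _ (isCompl_formsOfType r)

lemma proj_eq_iff (hp : p ∈ Q.frames x) {α : Covectors n k x} {β : Q.E k r x} :
    Q.proj k r x α = β ↔
      formEquiv p α - formEquiv p β ∈ formsOfOtherTypes ℝ (HSpace n) k r := by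
  have hE := Q.isCompl_E (k := k) (r := r) x
  have hsub : Submodule.projectionOnto _ _ hE (α - β) = Submodule.projectionOnto _ _ hE α - β := by
    rw [map_sub, Submodule.projectionOnto_apply_left]
  rw [proj, dif_pos hE, ← sub_eq_zero, ← hsub, Submodule.projectionOnto_apply_eq_zero_iff,
    Q.iSup_E_eq_comap hp, ← map_sub]
  rfl

end Sp1GLStructure

end Fibres

section Smooth

variable {D E F : Type*} [NormedAddCommGroup D] [NormedSpace ℝ D] [NormedAddCommGroup E]
  [NormedSpace ℝ E] [NormedAddCommGroup F] [NormedSpace ℝ F] {k : ℕ} {s : Set D}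

lemma contDiffOn_wedge {f : D → OneForm ℝ E} {g : D → Form ℝ E k} (hf : ContDiffOn ℝ ∞ f s)
    (hg : ContDiffOn ℝ ∞ g s) : ContDiffOn ℝ ∞ (fun z => wedge (f z) (g z)) s := by
  exact (hf.smulRight hg).continuousLinearMap_comp
    (ContinuousAlternatingMap.alternatizeUncurryFinCLM ℝ E ℝ)

lemma contDiffOn_compContinuousLinearMap [FiniteDimensional ℝ F] {B : D → E →L[ℝ] F}
    (hB : ContDiffOn ℝ ∞ B s) :
    ∀ {k : ℕ} (β : Form ℝ F k), ContDiffOn ℝ ∞ (fun z => β.compContinuousLinearMap (B z)) s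
  | 0, β => (contDiffOn_const (c := β.compContinuousLinearMap (0 : E →L[ℝ] F))).congr
      fun z _ => ContinuousAlternatingMap.ext fun v => congrArg β (Subsingleton.elim _ _)
  | k + 1, β => by
    let b := Module.finBasis ℝ F
    let x (i) : OneForm ℝ F := LinearMap.toContinuousLinearMap (b.coord i)
    have hβ : β = ((k : ℝ) + 1)⁻¹ • ∑ i, wedge (x i) (contr (b i) β) := by
      rw [sum_wedge_contr b x (fun _ _ => rfl), inv_smul_smul₀ (Nat.cast_add_one_ne_zero k)]
    have hcomp (z) : β.compContinuousLinearMap (B z) = ((k : ℝ) + 1)⁻¹ •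
        ∑ i, wedge (x i ∘L B z) ((contr (b i) β).compContinuousLinearMap (B z)) := by
      conv_lhs => rw [hβ]
      simp only [← wedge_compContinuousLinearMap]
      ext v
      simp
    simp only [hcomp]
    exact (ContDiffOn.sum fun i _ => contDiffOn_wedge (contDiffOn_const.clm_comp hB)
      (contDiffOn_compContinuousLinearMap hB _)).const_smul _

section Chart

variable {V F : Type*} [NormedAddCommGroup V] [NormedSpace ℝ V] [NormedAddCommGroup F]
  [NormedSpace ℝ F] {M : Type*} [TopologicalSpace M] [ChartedSpace V M]

lemma contDiffOn_mfderiv_extChartAt_apply [IsManifold 𝓘(ℝ, V) ∞ M] {U : Set M} (hU : IsOpen U)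
    {X : ∀ y : M, TangentSpace 𝓘(ℝ, V) y}
    (hX : ContMDiffOn 𝓘(ℝ, V) 𝓘(ℝ, V).tangent ∞ (fun y => (⟨y, X y⟩ : TangentBundle 𝓘(ℝ, V) M)) U)
    (x : M) :
    ContDiffOn ℝ ∞ (fun e => mfderiv 𝓘(ℝ, V) 𝓘(ℝ, V) (extChartAt 𝓘(ℝ, V) x)
        ((extChartAt 𝓘(ℝ, V) x).symm e) (X ((extChartAt 𝓘(ℝ, V) x).symm e)) : V → V)
      ((extChartAt 𝓘(ℝ, V) x).target ∩ (extChartAt 𝓘(ℝ, V) x).symm ⁻¹' U) := by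
  have hmem {e : V} (he : e ∈ (extChartAt 𝓘(ℝ, V) x).target) :
      (extChartAt 𝓘(ℝ, V) x).symm e ∈ (chartAt V x).source := by
    simpa using (extChartAt 𝓘(ℝ, V) x).map_target he
  have hsection : ContMDiffOn 𝓘(ℝ, V) 𝓘(ℝ, V) ∞
      (fun y => (trivializationAt V (TangentSpace 𝓘(ℝ, V)) x ⟨y, X y⟩).2)
      (U ∩ (chartAt V x).source) :=
    (Bundle.Trivialization.contMDiffOn_section_iff _ (hU.inter (chartAt V x).open_source)
      (by simp)).mp (hX.mono Set.inter_subset_left)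
  refine (contMDiffOn_iff_contDiffOn.mp (hsection.comp ((contMDiffOn_extChartAt_symm x).mono
    Set.inter_subset_left) fun e he => ⟨he.2, hmem he.1⟩)).congr fun e he => ?_
  rw [← TangentBundle.continuousLinearMapAt_trivializationAt (hmem he.1)]
  exact Bundle.Trivialization.continuousLinearMapAt_apply_of_mem (R := ℝ) _
    (by simpa using hmem he.1) _

/-- The inverse of the frame field `p` in the coordinates of the chart at `x`. -/
def invFrameInChart (p : ∀ y : M, TangentSpace 𝓘(ℝ, V) y ≃L[ℝ] F) (x : M) (e : V) : F →L[ℝ] V :=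
  (mfderiv 𝓘(ℝ, V) 𝓘(ℝ, V) (extChartAt 𝓘(ℝ, V) x) ((extChartAt 𝓘(ℝ, V) x).symm e)) ∘L
    ((p ((extChartAt 𝓘(ℝ, V) x).symm e)).symm : F →L[ℝ] _)

/-- The frame field `p` in the coordinates of the chart at `x`. -/
def frameInChart (p : ∀ y : M, TangentSpace 𝓘(ℝ, V) y ≃L[ℝ] F) (x : M) (e : V) : V →L[ℝ] F :=
  (p ((extChartAt 𝓘(ℝ, V) x).symm e) : _ →L[ℝ] F) ∘L
    (mfderiv 𝓘(ℝ, V) 𝓘(ℝ, V) (extChartAt 𝓘(ℝ, V) x).symm e)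

variable [IsManifold 𝓘(ℝ, V) ∞ M] {p : ∀ y : M, TangentSpace 𝓘(ℝ, V) y ≃L[ℝ] F} {x : M} {e : V}

lemma mfderiv_extChartAt_symm_mfderiv_extChartAt (he : e ∈ (extChartAt 𝓘(ℝ, V) x).target)
    (v : TangentSpace 𝓘(ℝ, V) ((extChartAt 𝓘(ℝ, V) x).symm e)) :
    mfderiv 𝓘(ℝ, V) 𝓘(ℝ, V) (extChartAt 𝓘(ℝ, V) x).symm e (mfderiv 𝓘(ℝ, V) 𝓘(ℝ, V)
      (extChartAt 𝓘(ℝ, V) x) ((extChartAt 𝓘(ℝ, V) x).symm e) v) = v := by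
  have h := mfderivWithin_extChartAt_symm_comp_mfderiv_extChartAt he
  rw [modelWithCornersSelf_coe, Set.range_id, mfderivWithin_univ] at h
  exact DFunLike.congr_fun h v

lemma mfderiv_extChartAt_mfderiv_extChartAt_symm (he : e ∈ (extChartAt 𝓘(ℝ, V) x).target)
    (v : V) :
    mfderiv 𝓘(ℝ, V) 𝓘(ℝ, V) (extChartAt 𝓘(ℝ, V) x) ((extChartAt 𝓘(ℝ, V) x).symm e)
      (mfderiv 𝓘(ℝ, V) 𝓘(ℝ, V) (extChartAt 𝓘(ℝ, V) x).symm e v) = v := by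
  have h := mfderiv_extChartAt_comp_mfderivWithin_extChartAt_symm he
  rw [modelWithCornersSelf_coe, Set.range_id, mfderivWithin_univ] at h
  exact DFunLike.congr_fun h v

lemma invFrameInChart_comp_frameInChart (he : e ∈ (extChartAt 𝓘(ℝ, V) x).target) :
    invFrameInChart p x e ∘L frameInChart p x e = .id ℝ V := by
  ext v
  exact (congrArg _ ((p _).symm_apply_apply _)).trans
    (mfderiv_extChartAt_mfderiv_extChartAt_symm he v)

lemma frameInChart_comp_invFrameInChart (he : e ∈ (extChartAt 𝓘(ℝ, V) x).target) :
    frameInChart p x e ∘L invFrameInChart p x e = .id ℝ F := by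
  ext v
  exact (congrArg (p _) (mfderiv_extChartAt_symm_mfderiv_extChartAt he _)).trans
    ((p _).apply_symm_apply v)

lemma contDiffOn_frameInChart [FiniteDimensional ℝ F] {U : Set M} (hU : IsOpen U)
    (hp : ∀ v : F, ContMDiffOn 𝓘(ℝ, V) 𝓘(ℝ, V).tangent ∞
      (fun y => (⟨y, (p y).symm v⟩ : TangentBundle 𝓘(ℝ, V) M)) U) (x : M) :
    ContDiffOn ℝ ∞ (frameInChart p x)
      ((extChartAt 𝓘(ℝ, V) x).target ∩ (extChartAt 𝓘(ℝ, V) x).symm ⁻¹' U) := by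
  have hinv : ContDiffOn ℝ ∞ (invFrameInChart p x)
      ((extChartAt 𝓘(ℝ, V) x).target ∩ (extChartAt 𝓘(ℝ, V) x).symm ⁻¹' U) :=
    contDiffOn_clm_apply.mpr fun v => contDiffOn_mfderiv_extChartAt_apply hU (hp v) x
  have hframe (e) (he : e ∈ (extChartAt 𝓘(ℝ, V) x).target) :
      frameInChart p x e = (invFrameInChart p x e).inverse :=
    (ContinuousLinearMap.inverse_eq (invFrameInChart_comp_frameInChart he)
      (frameInChart_comp_invFrameInChart he)).symm
  intro e he
  have hinvertible : (invFrameInChart p x e).IsInvertible := .of_inverse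
    (invFrameInChart_comp_frameInChart he.1) (frameInChart_comp_invFrameInChart he.1)
  exact (hinvertible.contDiffAt_map_inverse.comp_contDiffWithinAt e (hinv e he)).congr
    (fun e' he' => hframe e' he'.1) (hframe e he.1)

end Chart

end Smooth

section ExteriorDerivative

variable {n k : ℕ} {M : Type*} [TopologicalSpace M]
  [ChartedSpace (EuclideanSpace ℝ (Fin (4 * n))) M] {x : M} {f : M → ℝ}
  {s : ∀ y : M, Covectors n k y}

lemma hasFDerivAt_comp_extChartAt_symm (hf : MDifferentiableAt (𝓡 (4 * n)) 𝓘(ℝ, ℝ) f x) :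
    HasFDerivAt (f ∘ (extChartAt (𝓡 (4 * n)) x).symm) (mfderiv (𝓡 (4 * n)) 𝓘(ℝ, ℝ) f x)
      (extChartAt (𝓡 (4 * n)) x x) := by
  have h := hf.hasMFDerivAt.2
  rw [modelWithCornersSelf_coe, Set.range_id] at h
  exact hasFDerivWithinAt_univ.mp h

variable [IsManifold (𝓡 (4 * n)) ∞ M]

lemma localRep_extChartAt_self (s : ∀ y : M, Covectors n k y) (x : M) :
    localRep s x (extChartAt (𝓡 (4 * n)) x x) = s x := by
  have hid : mfderiv 𝓘(ℝ, EuclideanSpace ℝ (Fin (4 * n))) (𝓡 (4 * n))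
      (extChartAt (𝓡 (4 * n)) x).symm (extChartAt (𝓡 (4 * n)) x x) = .id ℝ _ := by
    simpa using! mfderivWithin_range_extChartAt_symm (I := 𝓡 (4 * n)) (x := x)
  have hs (y : M) (h : y = x) (v : Fin k → EuclideanSpace ℝ (Fin (4 * n))) : s y v = s x v := by
    subst h
    rfl
  ext v
  refine Eq.trans ?_ (hs _ (extChartAt_to_inv (I := 𝓡 (4 * n)) x) v)
  exact congrArg (s _) (funext fun i => DFunLike.congr_fun hid (v i))

lemma extD_smul (hf : MDifferentiableAt (𝓡 (4 * n)) 𝓘(ℝ, ℝ) f x) (hfx : f x = 0)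
    (hs : SmoothForm s) :
    extD (fun y => f y • s y) x = wedge (E := EuclideanSpace ℝ (Fin (4 * n)))
      (mfderiv (𝓡 (4 * n)) 𝓘(ℝ, ℝ) f x) (s x) := by
  have hs' : DifferentiableAt ℝ (localRep s x) (extChartAt (𝓡 (4 * n)) x x) :=
    ((hs x).contDiffAt (extChartAt_target_mem_nhds x)).differentiableAt (by simp)
  have hderiv := (hasFDerivAt_comp_extChartAt_symm hf).smul hs'.hasFDerivAt
  rw [Function.comp_apply, extChartAt_to_inv, hfx, zero_smul, zero_add,
    localRep_extChartAt_self] at hderiv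
  rw [extD, mfderiv_extChartAt_self, extDeriv]
  exact congrArg ContinuousAlternatingMap.alternatizeUncurryFin hderiv.fderiv

lemma formEquiv_extD_smul (p : LinearFrame n x)
    (hf : MDifferentiableAt (𝓡 (4 * n)) 𝓘(ℝ, ℝ) f x) (hfx : f x = 0) (hs : SmoothForm s) :
    formEquiv p (extD (fun y => f y • s y) x) =
      wedge (oneFormEquiv p (mfderiv (𝓡 (4 * n)) 𝓘(ℝ, ℝ) f x)) (formEquiv p (s x)) := by
  rw [extD_smul hf hfx hs]
  exact wedge_compContinuousLinearMap (E := EuclideanSpace ℝ (Fin (4 * n))) _ _ _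

end ExteriorDerivative

section Extension

variable {V : Type*} [NormedAddCommGroup V] [NormedSpace ℝ V] [FiniteDimensional ℝ V] {M : Type*}
  [TopologicalSpace M] [ChartedSpace V M] [IsManifold 𝓘(ℝ, V) ∞ M] [T2Space M]

lemma exists_contMDiff_mfderiv_eq (x : M) (ξ : TangentSpace 𝓘(ℝ, V) x →L[ℝ] ℝ) :
    ∃ f : M → ℝ, ContMDiff 𝓘(ℝ, V) 𝓘(ℝ, ℝ) ∞ f ∧ f x = 0 ∧ mfderiv 𝓘(ℝ, V) 𝓘(ℝ, ℝ) f x = ξ := by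
  obtain ⟨χ, -, -⟩ := (SmoothBumpFunction.nhds_basis_tsupport (I := 𝓘(ℝ, V)) x).mem_iff.mp
    Filter.univ_mem
  let ξ' : V →L[ℝ] ℝ := ξ
  let ℓ : V → ℝ := fun e => ξ' (e - extChartAt 𝓘(ℝ, V) x x)
  have hℓ : ContDiff ℝ ∞ ℓ := ξ'.contDiff.comp (contDiff_id.sub contDiff_const)
  have hℓ' : HasFDerivAt ℓ ξ' (extChartAt 𝓘(ℝ, V) x x) :=
    ξ'.hasFDerivAt.comp _ ((hasFDerivAt_id _).sub_const _)
  refine ⟨fun y => χ y • ℓ (extChartAt 𝓘(ℝ, V) x y),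
    χ.contMDiff_smul (hℓ.contMDiff.comp_contMDiffOn contMDiffOn_extChartAt), by simp [ℓ], ?_⟩
  have heq : (fun y => χ y • ℓ (extChartAt 𝓘(ℝ, V) x y)) =ᶠ[𝓝 x] ℓ ∘ extChartAt 𝓘(ℝ, V) x := by
    filter_upwards [χ.eventuallyEq_one] with y hy
    rw [hy]
    exact one_smul ℝ _
  have hcomp : mfderiv 𝓘(ℝ, V) 𝓘(ℝ, ℝ) (ℓ ∘ extChartAt 𝓘(ℝ, V) x) x = _ :=
    mfderiv_comp (I' := 𝓘(ℝ, V)) x (hℓ.contMDiff.mdifferentiable (by simp) _)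
      (mdifferentiableAt_extChartAt (mem_chart_source V x))
  rw [heq.mfderiv_eq, hcomp, mfderiv_extChartAt_self, mfderiv_eq_fderiv, hℓ'.fderiv]
  rfl

end Extension

section Symbol

variable {n k r : ℕ} {M : Type*} [TopologicalSpace M]
  [ChartedSpace (EuclideanSpace ℝ (Fin (4 * n))) M] [IsManifold (𝓡 (4 * n)) ∞ M] {U : Set M}

lemma contDiffOn_localRep_formEquiv_symm {p : ∀ y : M, LinearFrame n y} (hU : IsOpen U)
    (hp : SmoothFrameOn p U) (β : Form ℝ (HSpace n) k) (x : M) :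
    ContDiffOn ℝ ∞ (localRep (fun y => (formEquiv (p y)).symm β) x)
      ((extChartAt (𝓡 (4 * n)) x).target ∩ (extChartAt (𝓡 (4 * n)) x).symm ⁻¹' U) :=
  contDiffOn_compContinuousLinearMap (contDiffOn_frameInChart hU hp x) β

lemma smoothForm_smul_of_tsupport_subset {χ : M → ℝ} {η : ∀ y : M, Covectors n k y}
    (hχ : ContMDiff (𝓡 (4 * n)) 𝓘(ℝ, ℝ) ∞ χ) (hU : IsOpen U) (hsupp : tsupport χ ⊆ U)
    (hη : ∀ x, ContDiffOn ℝ ∞ (localRep η x)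
      ((extChartAt (𝓡 (4 * n)) x).target ∩ (extChartAt (𝓡 (4 * n)) x).symm ⁻¹' U)) :
    SmoothForm fun y => χ y • η y := by
  intro x e he
  have hsymm := contMDiffOn_extChartAt_symm (I := 𝓡 (4 * n)) (n := ∞) x
  have hopen (W : Set M) (hW : IsOpen W) : IsOpen ((extChartAt (𝓡 (4 * n)) x).target ∩
      (extChartAt (𝓡 (4 * n)) x).symm ⁻¹' W) :=
    (continuousOn_extChartAt_symm x).isOpen_inter_preimage (isOpen_extChartAt_target x) hW
  refine ContDiffAt.contDiffWithinAt ?_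
  by_cases hy : (extChartAt (𝓡 (4 * n)) x).symm e ∈ tsupport χ
  · have hχx := contMDiffOn_iff_contDiffOn.mp (hχ.comp_contMDiffOn hsymm)
    exact ((hχx.mono Set.inter_subset_left).smul (hη x)).contDiffAt
      ((hopen U hU).mem_nhds ⟨he, hsupp hy⟩)
  · have hzero : localRep (fun y => χ y • η y) x =ᶠ[𝓝 e] fun _ => 0 := by
      filter_upwards [(hopen _ (isClosed_tsupport χ).isOpen_compl).mem_nhds ⟨he, hy⟩] with e' he'
      rw [localRep, image_eq_zero_of_notMem_tsupport he'.2, zero_smul]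
      rfl
    exact contDiffAt_const.congr_of_eventuallyEq hzero

namespace Sp1GLStructure

variable (Q : Sp1GLStructure n M) {x : M} {p : LinearFrame n x}

lemma forall_E_iff (hp : p ∈ Q.frames x) {P : Form ℝ (HSpace n) k → Prop} :
    (∀ α : Q.E k r x, P (formEquiv p α)) ↔ ∀ β ∈ formsOfType ℝ (HSpace n) k r, P β := by
  rw [(formEquiv p).surjective.forall]
  simp only [Subtype.forall, Q.mem_E_iff hp]

lemma exists_E_iff (hp : p ∈ Q.frames x) {P : Form ℝ (HSpace n) k → Prop} :
    (∃ α : Q.E k r x, P (formEquiv p α)) ↔ ∃ β ∈ formsOfType ℝ (HSpace n) k r, P β := by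
  rw [(formEquiv p).surjective.exists]
  simp only [Subtype.exists, Q.mem_E_iff hp, exists_prop]

variable [T2Space M]

lemma exists_smoothForm_eq (α : Q.E k r x) :
    ∃ s : ∀ y : M, Q.E k r y, SmoothForm (fun y => (s y : Covectors n k y)) ∧ s x = α := by
  obtain ⟨U, hU, p, hp, hsmooth⟩ := Q.exists_section x
  obtain ⟨χ, -, hχ⟩ := (SmoothBumpFunction.nhds_basis_tsupport (I := 𝓡 (4 * n)) x).mem_iff.mp
    (interior_mem_nhds.mpr hU)
  let η (y : M) : Covectors n k y := (formEquiv (p y)).symm (formEquiv (p x) α)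
  have hη (y) (hy : y ∈ U) : η y ∈ Q.E k r y := by
    rw [Q.mem_E_iff (hp y hy), ContinuousLinearEquiv.apply_symm_apply]
    exact (Q.mem_E_iff (hp x (mem_of_mem_nhds hU))).mp α.2
  have hmem (y) : χ y • η y ∈ Q.E k r y := by
    by_cases hy : y ∈ tsupport χ
    · exact Submodule.smul_mem _ _ (hη y (interior_subset (hχ hy)))
    · rw [image_eq_zero_of_notMem_tsupport hy, zero_smul]
      exact zero_mem _
  refine ⟨fun y => ⟨_, hmem y⟩, ?_, Subtype.ext ?_⟩
  · exact smoothForm_smul_of_tsupport_subset χ.contMDiff isOpen_interior hχ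
      (contDiffOn_localRep_formEquiv_symm isOpen_interior
        (fun v => (hsmooth v).mono interior_subset) _)
  · dsimp only [η]
    rw [χ.eq_one, one_smul, ContinuousLinearEquiv.symm_apply_apply]

lemma symbol_apply (p : LinearFrame n x) (ξ : TangentSpace (𝓡 (4 * n)) x →L[ℝ] ℝ)
    (α : Q.E k r x) :
    Q.symbol k r x ξ α = Q.proj (k + 1) (r + 1) x
      ((formEquiv p).symm (wedge (oneFormEquiv p ξ) (formEquiv p (α : Covectors n k x)))) := by
  have hD (f : M → ℝ) (s : ∀ y : M, Q.E k r y) (hf : ContMDiff (𝓡 (4 * n)) 𝓘(ℝ, ℝ) ∞ f)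
      (hfx : f x = 0) (hξ : mfderiv (𝓡 (4 * n)) 𝓘(ℝ, ℝ) f x = ξ)
      (hs : SmoothForm fun y => (s y : Covectors n k y)) :
      Q.opD k r (fun y => f y • (s y : Covectors n k y)) x = Q.proj (k + 1) (r + 1) x
        ((formEquiv p).symm (wedge (oneFormEquiv p ξ) (formEquiv p (s x : Covectors n k x)))) := by
    rw [opD, ← hξ, ← formEquiv_extD_smul p (hf.contMDiffAt.mdifferentiableAt (by simp)) hfx hs,
      ContinuousLinearEquiv.symm_apply_apply]
  have hex : ∃ σ, Q.IsPrincipalSymbol k r x ξ σ :=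
    ⟨Q.proj (k + 1) (r + 1) x ∘ₗ (formEquiv p).symm.toLinearMap ∘ₗ
      wedge (oneFormEquiv p ξ) ∘ₗ (formEquiv p).toLinearMap ∘ₗ (Q.E k r x).subtype,
      fun f s hf hfx hξ hs => (hD f s hf hfx hξ hs).symm⟩
  obtain ⟨f, hf, hfx, hξ⟩ := exists_contMDiff_mfderiv_eq x ξ
  obtain ⟨s, hs, rfl⟩ := Q.exists_smoothForm_eq α
  rw [symbol, dif_pos hex, hex.choose_spec f s hf hfx hξ hs, hD f s hf hfx hξ hs]

lemma symbol_eq_iff (hp : p ∈ Q.frames x) {ξ : TangentSpace (𝓡 (4 * n)) x →L[ℝ] ℝ}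
    {α : Q.E k r x} {β : Q.E (k + 1) (r + 1) x} :
    Q.symbol k r x ξ α = β ↔
      wedge (oneFormEquiv p ξ) (formEquiv p (α : Covectors n k x)) -
        formEquiv p (β : Covectors n (k + 1) x) ∈
          formsOfOtherTypes ℝ (HSpace n) (k + 1) (r + 1) := by
  rw [Q.symbol_apply p, Q.proj_eq_iff hp, ContinuousLinearEquiv.apply_symm_apply]

lemma symbol_eq_zero_iff (hp : p ∈ Q.frames x) {ξ : TangentSpace (𝓡 (4 * n)) x →L[ℝ] ℝ}
    {α : Q.E k r x} :
    Q.symbol k r x ξ α = 0 ↔ wedge (oneFormEquiv p ξ) (formEquiv p (α : Covectors n k x)) ∈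
      formsOfOtherTypes ℝ (HSpace n) (k + 1) (r + 1) := by
  rw [Q.symbol_eq_iff hp, Submodule.coe_zero, map_zero, sub_zero]

lemma exact_symbol_iff (hp : p ∈ Q.frames x) {ξ : TangentSpace (𝓡 (4 * n)) x →L[ℝ] ℝ} :
    Function.Exact (Q.symbol k r x ξ) (Q.symbol (k + 1) (r + 1) x ξ) ↔
      ∀ β ∈ formsOfType ℝ (HSpace n) (k + 1) (r + 1),
        wedge (oneFormEquiv p ξ) β ∈ formsOfOtherTypes ℝ (HSpace n) (k + 2) (r + 2) ↔
          ∃ γ ∈ formsOfType ℝ (HSpace n) k r, wedge (oneFormEquiv p ξ) γ - β ∈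
            formsOfOtherTypes ℝ (HSpace n) (k + 1) (r + 1) := by
  rw [← Q.forall_E_iff hp]
  refine forall_congr' fun β => iff_congr (Q.symbol_eq_zero_iff hp) ?_
  rw [← Q.exists_E_iff hp]
  exact exists_congr fun γ => Q.symbol_eq_iff hp

lemma injective_symbol_iff (hp : p ∈ Q.frames x) {ξ : TangentSpace (𝓡 (4 * n)) x →L[ℝ] ℝ} :
    Function.Injective (Q.symbol k r x ξ) ↔ ∀ β ∈ formsOfType ℝ (HSpace n) k r,
      wedge (oneFormEquiv p ξ) β ∈ formsOfOtherTypes ℝ (HSpace n) (k + 1) (r + 1) → β = 0 := by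
  rw [injective_iff_map_eq_zero, ← Q.forall_E_iff hp]
  refine forall_congr' fun β => imp_congr (Q.symbol_eq_zero_iff hp) ?_
  rw [EmbeddingLike.map_eq_zero_iff, Submodule.coe_eq_zero]

lemma ellipticAt_succ {k j : ℕ} (h : k = 0 ∨ 0 < j) : Q.EllipticAt k (j + 1) := by
  intro x ξ hξ
  obtain ⟨p, hp⟩ := Q.frames_nonempty x
  rw [← (oneFormEquiv p).map_ne_zero_iff] at hξ
  exact (Q.exact_symbol_iff hp).mpr fun β hβ =>
    wedge_mem_formsOfOtherTypes_iff hξ (by omega) hβ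

lemma ellipticAt_zero_zero : Q.EllipticAt 0 0 := by
  intro x ξ hξ
  obtain ⟨p, hp⟩ := Q.frames_nonempty x
  rw [← (oneFormEquiv p).map_ne_zero_iff] at hξ
  exact (Q.injective_symbol_iff hp).mpr fun β hβ h =>
    zeroForm_eq_zero_of_wedge_eq_zero hξ ((wedge_mem_formsOfOtherTypes_one_iff hβ).mp h)

lemma ellipticAt_one_zero : Q.EllipticAt 1 0 := by
  intro x ξ hξ
  obtain ⟨p, hp⟩ := Q.frames_nonempty x
  rw [← (oneFormEquiv p).map_ne_zero_iff] at hξ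
  exact (Q.injective_symbol_iff hp).mpr fun β hβ h =>
    eq_zero_of_wedge_eq_zero_of_invariant hξ hβ ((wedge_mem_formsOfOtherTypes_one_iff hβ).mp h)

end Sp1GLStructure

lemma exists_HSpace_wedgeVolume_ne_zero {n k : ℕ} (hk : k + 2 ≤ 2 * n) :
    ∃ ξ, ∃ ρ ∈ formsOfType ℝ (HSpace n) (2 * k) 0, wedgeVolume ξ ρ ≠ 0 := by
  let reCoord (i : Fin n) : OneForm ℝ (HSpace n) := LinearMap.toContinuousLinearMap
    ((QuaternionAlgebra.reₗ (-1 : ℝ) 0 (-1)).comp (LinearMap.proj i : HSpace n →ₗ[ℝ] ℍ[ℝ]))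
  refine exists_wedgeVolume_ne_zero (a := reCoord) (e := fun j => Pi.single j 1)
    (fun i j q => ?_) hk
  change (q • (Pi.single j (1 : ℍ[ℝ]) : HSpace n) i).re = _
  obtain rfl | h := eq_or_ne i j <;> simp [*]

namespace Sp1GLStructure

variable (Q : Sp1GLStructure n M) [T2Space M] [Nonempty M]

lemma not_ellipticAt_zero (hk : 2 ≤ k) (hkn : k ≤ 2 * n) : ¬ Q.EllipticAt k 0 := by
  intro h
  obtain ⟨x⟩ := ‹Nonempty M›
  obtain ⟨p, hp⟩ := Q.frames_nonempty x
  obtain ⟨N, rfl⟩ := Nat.exists_eq_add_of_le' hk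
  obtain ⟨ξ, ρ, hρ, hξρ⟩ := exists_HSpace_wedgeVolume_ne_zero hkn
  obtain ⟨β, hβ, hβ0, hξβ⟩ := exists_ne_zero_wedge_eq_zero hρ hξρ
  obtain ⟨η, rfl⟩ := (oneFormEquiv p).surjective ξ
  have hη : η ≠ 0 := (oneFormEquiv p).map_ne_zero_iff.mp (ne_zero_of_wedgeVolume_ne_zero hξρ)
  exact hβ0 ((Q.injective_symbol_iff hp).mp (h x η hη) β hβ (hξβ ▸ zero_mem _))

lemma not_ellipticAt_one (hk : 1 ≤ k) (hkn : k < 2 * n) : ¬ Q.EllipticAt k 1 := by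
  intro h
  obtain ⟨x⟩ := ‹Nonempty M›
  obtain ⟨p, hp⟩ := Q.frames_nonempty x
  obtain ⟨N, rfl⟩ := Nat.exists_eq_add_of_le' hk
  obtain ⟨ξ, ρ, hρ, hξρ⟩ := exists_HSpace_wedgeVolume_ne_zero (n := n) (k := N) (by omega)
  obtain ⟨β, hβ, hξβ, hne⟩ := exists_wedge_mem_formsOfOtherTypes_two hρ hξρ
  obtain ⟨η, rfl⟩ := (oneFormEquiv p).surjective ξ
  have hη : η ≠ 0 := (oneFormEquiv p).map_ne_zero_iff.mp (ne_zero_of_wedgeVolume_ne_zero hξρ)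
  exact hne (((Q.exact_symbol_iff hp).mp (h x η hη) β hβ).mp hξβ)

end Sp1GLStructure

end Symbol

end QuaternionicForms

end

theorem theorem5p1_general {n : ℕ} {M : Type*} [TopologicalSpace M] [T2Space M] [Nonempty M]
    [ChartedSpace (EuclideanSpace ℝ (Fin (4 * n))) M] [IsManifold (𝓡 (4 * n)) ∞ M]
    (Q : QuaternionicForms.Sp1GLStructure n M) (k : ℕ) (hk : k ≤ 2 * n) :
    (2 * k ≥ 4 →
      ¬ Q.EllipticAt k 0 ∧ (k < 2 * n → ¬ Q.EllipticAt k 1) ∧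
        ∀ j : ℕ, 2 ≤ j → k + j ≤ 2 * n → Q.EllipticAt k j) ∧
    (k = 1 →
      Q.EllipticAt k 0 ∧ ¬ Q.EllipticAt k 1 ∧
        ∀ j : ℕ, 2 ≤ j → k + j ≤ 2 * n → Q.EllipticAt k j) ∧
    (k = 0 → ∀ j : ℕ, k + j ≤ 2 * n → Q.EllipticAt k j) := by
  have hj : ∀ j : ℕ, 2 ≤ j → k + j ≤ 2 * n → Q.EllipticAt k j := by
    intro j hj _
    obtain ⟨j, rfl⟩ := Nat.exists_eq_add_of_le' (show 1 ≤ j by omega)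
    exact Q.ellipticAt_succ (Or.inr (by omega))
  refine ⟨fun h => ⟨Q.not_ellipticAt_zero (by omega) hk, fun hlt => ?_, hj⟩, ?_, ?_⟩
  · exact Q.not_ellipticAt_one (by omega) hlt
  · rintro rfl
    exact ⟨Q.ellipticAt_one_zero, Q.not_ellipticAt_one le_rfl (by omega), hj⟩
  · rintro rfl j _
    rcases j with _ | j
    · exact Q.ellipticAt_zero_zero
    · exact Q.ellipticAt_succ (Or.inl rfl)

theorem theorem5p1 {n : ℕ} {M : Type*} [TopologicalSpace M] [T2Space M]
    [SecondCountableTopology M] [Nonempty M]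
    [ChartedSpace (EuclideanSpace ℝ (Fin (4 * n))) M] [IsManifold (𝓡 (4 * n)) ∞ M]
    (Q : QuaternionicForms.Sp1GLStructure n M) (hQ : Q.IsQuaternionic)
    (k : ℕ) (hk : k ≤ 2 * n) :
    (2 * k ≥ 4 →
      ¬ Q.EllipticAt k 0 ∧ (k < 2 * n → ¬ Q.EllipticAt k 1) ∧
        ∀ j : ℕ, 2 ≤ j → k + j ≤ 2 * n → Q.EllipticAt k j) ∧
    (k = 1 →
      Q.EllipticAt k 0 ∧ ¬ Q.EllipticAt k 1 ∧
        ∀ j : ℕ, 2 ≤ j → k + j ≤ 2 * n → Q.EllipticAt k j) ∧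
    (k = 0 → ∀ j : ℕ, k + j ≤ 2 * n → Q.EllipticAt k j) :=
  theorem5p1_general Q k hk
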